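/- **Setting.** Let $\mathcal N$ be a countably infinite set of names containing a special name $\mathit{out}$ and, for every natural number $n$, a name denoted $n$; the name $\mathit{out}$ and the numbers are never used as bound names. Processes of the mixed-choice $\pi$-calculus are $$P ::= \textstyle\sum_i \alpha_i.P_i \mid \nu x\,P \mid P\,|\,P \mid\; !P,\qquad \alpha ::= x(y)\mid \bar x y\mid \tau,$$ with finite ordered sums. The separate-choice calculus $\pi_s$ consists of the processes in which no sum has both input and output prefixes among its guards. Transitions $P\xrightarrow{\mu}P'$, with $\mu ::= xy\mid \bar x y\mid \bar x(y)\mid\tau$, are those of the standard early semantics (rules for sums, Open, Res, Par, Com, Close, Rep), closed under the congruence $\equiv$ generated by $\alpha$-conversion and by $(\nu x P)\,|\,Q\equiv\nu x(P\,|\,Q)$ for $x\notin \mathrm{fn}(Q)$. A *network* $P=[P_0|\cdots|P_{k-1}]$ consists of distinct bound names $x_0,\dots,x_{n-1}$ and processes $P_0,\dots,P_{k-1}$, and represents the process $\nu x_0\cdots\nu x_{n-1}(P_0|\cdots|P_{k-1})$; it is in $\pi_s$ if all the $P_i$ are. A *computation* of $P$ is a finite or infinite sequence of transitions between networks with $k$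 components that starts from $P$; the structure of a network is restored after each step by means of $\equiv$. Its *projection* over $i$ is the sequence of transitions that the $i$-th component contributes. $C'$ *extends* $C$ if $C$ is an initial segment of $C'$ (possibly $C'=C$). $P$ is an *electoral system* if every computation $C$ of $P$ has an extension $C'$ for which there is $n\in\{0,\dots,k-1\}$ such that for each $i\in\{0,\dots,k-1\}$ the projection of $C'$ over $i$ contains the output action $\overline{\mathit{out}}\,n$, and no extension of $C'$ contains an action $\overline{\mathit{out}}\,m$ with $m\in\{0,\dots,k-1\}$, $m\ne n$. The *hypergraph* $H(P)$ has nodes $N=\{0,\dots,k-1\}$ and edges $X=\mathrm{fn}(P_0|\cdots|P_{k-1})\setminus\{\mathit{out}\}$, the edge $x$ connecting the set of nodes $t(x)=\{i\mid x\in\mathrm{fn}(P_i)\}$. An *automorphism* of $H(P)$ is a pair $\sigma=\langle\sigma_N,\sigma_X\rangle$ of permutations of $N$ and of $X$ with $t(\sigma_X(x))=\sigma_N(t(x))$ for all $x\in X$. It is *well-balanced* if all the orbits of $\sigma_N$ on $N$ have the same cardinality. $P$ is *symmetric with respect to* $\sigma$ if $\sigma_X$ and $\sigma_N$ coincide on $N\cap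 X$, $\sigma_X(x)\in\{x_0,\dots,x_{n-1}\}$ if and only if $x\in\{x_0,\dots,x_{n-1}\}$ for all $x\in X$, and for each node $i$ the process $P_{\sigma_N(i)}$ is, up to $\alpha$-conversion, the process obtained from $P_i$ by renaming its free names according to $\sigma_X$ (leaving $\mathit{out}$ unchanged). **Statement.** Let $P=[P_0|\cdots|P_{k-1}]$ be a network in $\pi_s$. Assume that $H(P)$ admits a well-balanced automorphism $\sigma=\langle\sigma_N,\sigma_X\rangle\neq\langle\mathrm{id}_N,\mathrm{id}_X\rangle$ and that $P$ is symmetric with respect to $\sigma$. Then $P$ is not an electoral system. -/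

import Mathlib

namespace PiCalc

/-! ### Names

`out` is the special channel to the external world, `id n` is the name that stands for the
natural number `n` (used to identify the components of a network), and `ch n` are the remaining
names. Only names `ch n` can be bound.

Terms are taken up to alpha-conversion, by means of de Bruijn indices: under a binder, `ch 0` is
the bound name, and a name `ch n` from outside the binder is written `ch (n + 1)`. -/

inductive Name : Type
  | out : Name
  | id (n : ℕ) : Name
  | ch (n : ℕ) : Name
  deriving DecidableEq

namespace Name

/-- A name from outside a binder, as written under the binder. -/
def shift : Name → Name
  | ch n => ch (n + 1)
  | x => x

/-- The left inverse of `shift` (used only on names different from `ch 0`). -/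
def unshift : Name → Name
  | ch (n + 1) => ch n
  | x => x

/-- The renaming that instantiates the bound name of a removed binder with `y`. -/
def inst (y : Name) : Name → Name
  | ch 0 => y
  | ch (n + 1) => ch n
  | x => x

/-- The renaming that makes `ch x` the bound name of a new binder. -/
def bindName (x : ℕ) : Name → Name
  | ch n => if n = x then ch 0 else ch (n + 1)
  | y => y

/-- A renaming, transported under a binder (it fixes the bound name and avoids capture). -/
def lift (f : Name → Name) : Name → Name
  | ch 0 => ch 0
  | ch (n + 1) => shift (f (ch n))
  | x => shift (f x)

end Name

open Name

/-! ### Syntax -/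

/-- Prefixes: `inp x` is `x(y)`, whose formal parameter `y` is bound in the continuation,
`out x y` is the output of `y` on `x`. -/
inductive Prefix : Type
  | inp (x : Name) : Prefix
  | out (x y : Name) : Prefix
  | tau : Prefix

/-- Terms of the mixed-choice calculus: finite guarded sums `∑ i, pre i . cont i`, restriction,
parallel composition, replication. -/
inductive Proc : Type
  | sum (m : ℕ) (pre : Fin m → Prefix) (cont : Fin m → Proc) : Proc
  | nu (P : Proc) : Proc
  | par (P Q : Proc) : Proc
  | rep (P : Proc) : Proc

namespace Prefix

def rename (f : Name → Name) : Prefix → Prefix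
  | inp x => inp (f x)
  | out x y => out (f x) (f y)
  | tau => tau

/-- The renaming to apply in the continuation of a prefix. -/
def under (f : Name → Name) : Prefix → Name → Name
  | inp _ => lift f
  | _ => f

def names : Prefix → Finset Name
  | inp x => {x}
  | out x y => {x, y}
  | tau => ∅

/-- The free names of a term that stands in the scope of a binder, seen from outside. -/
def unbind (s : Finset Name) : Finset Name := (s.erase (ch 0)).image unshift

/-- The names that a continuation with free names `s` contributes after the prefix. -/
def scope (s : Finset Name) : Prefix → Finset Name
  | inp _ => unbind s
  | _ => s

def IsInput : Prefix → Prop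
  | inp _ => True
  | _ => False

def IsOutput : Prefix → Prop
  | out _ _ => True
  | _ => False

end Prefix

namespace Proc

/-- Capture-avoiding renaming of the free names. -/
def rename (f : Name → Name) : Proc → Proc
  | sum m pre cont =>
      sum m (fun i => (pre i).rename f) (fun i => (cont i).rename ((pre i).under f))
  | nu P => nu (P.rename (lift f))
  | par P Q => par (P.rename f) (Q.rename f)
  | rep P => rep (P.rename f)

/-- Free names. -/
def fn : Proc → Finset Name
  | sum _ pre cont => Finset.univ.biUnion fun i => (pre i).names ∪ (pre i).scope (cont i).fn
  | nu P => Prefix.unbind P.fn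
  | par P Q => P.fn ∪ Q.fn
  | rep P => P.fn

/-- Inaction, the empty sum. -/
def nil : Proc := sum 0 Fin.elim0 Fin.elim0

/-- `νx P` for the name `x = ch x` (and `P` with `x` possibly free). -/
def res (x : ℕ) (P : Proc) : Proc := nu (P.rename (bindName x))

/-- `νx₀ νx₁ … P`. -/
def resList (xs : List ℕ) (P : Proc) : Proc := xs.foldr res P

/-- `P₀ | P₁ | … | Pₖ₋₁`, associated to the left. -/
def parAll : {k : ℕ} → (Fin k → Proc) → Proc
  | 0, _ => nil
  | 1, P => P 0
  | k + 2, P => par (parAll fun i : Fin (k + 1) => P i.castSucc) (P (Fin.last (k + 1)))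

/-- The terms of the separate-choice calculus: no sum, at any depth, has both an input and an
output prefix among its guards. -/
def Separate : Proc → Prop
  | sum _ pre cont =>
      ((∀ i, ¬ (pre i).IsOutput) ∨ (∀ i, ¬ (pre i).IsInput)) ∧ ∀ i, (cont i).Separate
  | nu P => P.Separate
  | par P Q => P.Separate ∧ Q.Separate
  | rep P => P.Separate

end Proc

/-! ### Operational semantics -/

/-- Actions: input `x y`, free output, bound output (of the name `ch y`), silent action. -/
inductive Action : Type
  | inp (x y : Name) : Action
  | out (x y : Name) : Action
  | bout (x : Name) (y : ℕ) : Action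
  | tau : Action

namespace Action

def names : Action → Finset Name
  | inp x y => {x, y}
  | out x y => {x, y}
  | bout x y => {x, ch y}
  | tau => ∅

/-- Bound names. -/
def bn : Action → Finset Name
  | bout _ y => {ch y}
  | _ => ∅

end Action

/-- Structural congruence: the congruence generated by alpha-conversion (which is equality here)
and scope expansion. -/
inductive StructCong : Proc → Proc → Prop
  | refl (P : Proc) : StructCong P P
  | symm {P Q : Proc} : StructCong P Q → StructCong Q P
  | trans {P Q R : Proc} : StructCong P Q → StructCong Q R → StructCong P R
  | sum {m : ℕ} {pre : Fin m → Prefix} {P Q : Fin m → Proc} :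
      (∀ i, StructCong (P i) (Q i)) → StructCong (.sum m pre P) (.sum m pre Q)
  | nu {P Q : Proc} : StructCong P Q → StructCong (.nu P) (.nu Q)
  | par {P P' Q Q' : Proc} :
      StructCong P P' → StructCong Q Q' → StructCong (.par P Q) (.par P' Q')
  | rep {P Q : Proc} : StructCong P Q → StructCong (.rep P) (.rep Q)
  | scope {P Q : Proc} {x : ℕ} :
      ch x ∉ Q.fn → StructCong (.par (P.res x) Q) ((Proc.par P Q).res x)

/-- The early transition system. -/
inductive Trans : Proc → Action → Proc → Prop
  | inpSum {m : ℕ} {pre : Fin m → Prefix} {P : Fin m → Proc} (j : Fin m) {x : Name} (y : Name) :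
      pre j = .inp x → Trans (.sum m pre P) (.inp x y) ((P j).rename (inst y))
  | outSum {m : ℕ} {pre : Fin m → Prefix} {P : Fin m → Proc} (j : Fin m) {x y : Name} :
      pre j = .out x y → Trans (.sum m pre P) (.out x y) (P j)
  | tauSum {m : ℕ} {pre : Fin m → Prefix} {P : Fin m → Proc} (j : Fin m) :
      pre j = .tau → Trans (.sum m pre P) .tau (P j)
  | opn {P P' : Proc} {x : Name} {y : ℕ} :
      Trans P (.out x (ch y)) P' → x ≠ ch y → Trans (P.res y) (.bout x y) P'
  | res {P P' : Proc} {μ : Action} {y : ℕ} :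
      Trans P μ P' → ch y ∉ μ.names → Trans (P.res y) μ (P'.res y)
  | parL {P P' Q : Proc} {μ : Action} :
      Trans P μ P' → Disjoint μ.bn Q.fn → Trans (.par P Q) μ (.par P' Q)
  | parR {P Q Q' : Proc} {μ : Action} :
      Trans Q μ Q' → Disjoint μ.bn P.fn → Trans (.par P Q) μ (.par P Q')
  | comL {P P' Q Q' : Proc} {x y : Name} :
      Trans P (.inp x y) P' → Trans Q (.out x y) Q' → Trans (.par P Q) .tau (.par P' Q')
  | comR {P P' Q Q' : Proc} {x y : Name} :
      Trans P (.out x y) P' → Trans Q (.inp x y) Q' → Trans (.par P Q) .tau (.par P' Q')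
  | closeL {P P' Q Q' : Proc} {x : Name} {y : ℕ} :
      Trans P (.inp x (ch y)) P' → Trans Q (.bout x y) Q' → ch y ∉ P.fn →
        Trans (.par P Q) .tau ((Proc.par P' Q').res y)
  | closeR {P P' Q Q' : Proc} {x : Name} {y : ℕ} :
      Trans P (.bout x y) P' → Trans Q (.inp x (ch y)) Q' → ch y ∉ Q.fn →
        Trans (.par P Q) .tau ((Proc.par P' Q').res y)
  | rep {P P' : Proc} {μ : Action} :
      Trans (.par P (.rep P)) μ P' → Trans (.rep P) μ P'
  | cong {P P' Q Q' : Proc} {μ : Action} :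
      StructCong P' P → Trans P μ Q → StructCong Q Q' → Trans P' μ Q'

/-! ### Hypergraphs and automorphisms -/

structure Hypergraph where
  Node : Type
  Edge : Type
  finite_node : Finite Node
  finite_edge : Finite Edge
  /-- The set of nodes connected by an edge. -/
  type : Edge → Set Node

namespace Hypergraph

structure Automorphism (H : Hypergraph) where
  node : Equiv.Perm H.Node
  edge : Equiv.Perm H.Edge
  type_edge : ∀ x, H.type (edge x) = node '' H.type x

/-- The identity automorphism. -/
def Automorphism.id (H : Hypergraph) : H.Automorphism where
  node := Equiv.refl _
  edge := Equiv.refl _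
  type_edge x := by simp

/-- The orbit of a node. -/
def Automorphism.orbit {H : Hypergraph} (σ : H.Automorphism) (n : H.Node) : Set H.Node :=
  {m | ∃ i : ℕ, (σ.node ^ i) n = m}

/-- All orbits have the same cardinality. -/
def Automorphism.WellBalanced {H : Hypergraph} (σ : H.Automorphism) : Prop :=
  ∀ n m : H.Node, (σ.orbit n).ncard = (σ.orbit m).ncard

end Hypergraph

/-! ### Networks -/

/-- A network `νx₀ … νxₙ₋₁ (P₀ | … | Pₖ₋₁)` with `k` components. -/
structure Network (k : ℕ) where
  binders : List ℕ
  nodup : binders.Nodup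
  comp : Fin k → Proc

namespace Network

variable {k : ℕ}

/-- The term represented by a network. -/
def toProc (P : Network k) : Proc := Proc.resList P.binders (Proc.parAll P.comp)

/-- The network belongs to the separate-choice calculus. -/
def Separate (P : Network k) : Prop := ∀ i, (P.comp i).Separate

/-- The free names of `P₀ | … | Pₖ₋₁` other than `out`. -/
def edgeNames (P : Network k) : Finset Name :=
  (Finset.univ.biUnion fun i => (P.comp i).fn).erase out

/-- The hypergraph associated to a network. -/
def hypergraph (P : Network k) : Hypergraph where
  Node := Fin k
  Edge := {x : Name // x ∈ P.edgeNames}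
  finite_node := inferInstance
  finite_edge := inferInstance
  type x := {i | x.1 ∈ (P.comp i).fn}

/-- The globally bound names. -/
def boundNames (P : Network k) : Set Name := {x | ∃ n ∈ P.binders, x = ch n}

/-- An automorphism of the hypergraph is an automorphism of the network if it acts in the same way
on a node and on the name of that node, and preserves the distinction between free and globally
bound names. -/
structure IsAutomorphism (P : Network k) (σ : P.hypergraph.Automorphism) : Prop where
  edge_id : ∀ (i : Fin k) (h : Name.id i ∈ P.edgeNames),
    (σ.edge ⟨Name.id i, h⟩).1 = Name.id (show Fin k from σ.node i : Fin k)
  bound_iff : ∀ x : {x : Name // x ∈ P.edgeNames},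
    x.1 ∈ P.boundNames ↔ (σ.edge x).1 ∈ P.boundNames

/-- The action of an automorphism on names, the identity on names that are not edges. -/
def onNames (P : Network k) (σ : P.hypergraph.Automorphism) (x : Name) : Name :=
  if h : x ∈ P.edgeNames then (σ.edge ⟨x, h⟩).1 else x

/-- `P` is symmetric with respect to `σ`: `σ` is an automorphism on `P` and the component of the
node `σ i` is the `σ`-renaming of the component of the node `i` (up to alpha-conversion). -/
def SymmetricWrt (P : Network k) (σ : P.hypergraph.Automorphism) : Prop :=
  P.IsAutomorphism σ ∧ ∀ i : Fin k, P.comp (σ.node i) = (P.comp i).rename (P.onNames σ)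

/-! ### Computations of networks -/

/-- `BodyStep P act μ new Q`: the parallel composition of the components `P` performs `μ`. Either
one component moves alone (rule Par), or two components communicate (rules Com and Close); in the
latter case `new` lists the restricted name created by Close. `act i` is the action contributed by
the component `i` (`none` if it is idle) and `Q i` is what the component becomes. -/
inductive BodyStep (P : Fin k → Proc) :
    (Fin k → Option Action) → Action → List ℕ → (Fin k → Proc) → Prop
  | move (i : Fin k) {μ : Action} {Q : Proc} :
      Trans (P i) μ Q → (∀ l, l ≠ i → Disjoint μ.bn (P l).fn) →
        BodyStep P (Function.update (fun _ => none) i (some μ)) μ [] (Function.update P i Q)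
  | com (i j : Fin k) {x y : Name} {Q R : Proc} : i ≠ j →
      Trans (P i) (.inp x y) Q → Trans (P j) (.out x y) R →
        BodyStep P
          (Function.update (Function.update (fun _ => none) i (some (.inp x y)))
            j (some (.out x y)))
          .tau [] (Function.update (Function.update P i Q) j R)
  | close (i j : Fin k) {x : Name} {y : ℕ} {Q R : Proc} : i ≠ j →
      Trans (P i) (.inp x (ch y)) Q → Trans (P j) (.bout x y) R →
      (∀ l, l ≠ j → ch y ∉ (P l).fn) →
        BodyStep P
          (Function.update (Function.update (fun _ => none) i (some (.inp x (ch y))))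
            j (some (.bout x y)))
          .tau [y] (Function.update (Function.update P i Q) j R)

/-- `BinderStep xs μ ys μ'`: by the rules Res and Open, an action `μ` in the scope of the
restrictions `xs` becomes the action `μ'`, and the restrictions `ys` remain. -/
inductive BinderStep : List ℕ → Action → List ℕ → Action → Prop
  | nil (μ : Action) : BinderStep [] μ [] μ
  | res {xs ys : List ℕ} {μ μ' : Action} {y : ℕ} :
      BinderStep xs μ ys μ' → ch y ∉ μ'.names → BinderStep (y :: xs) μ (y :: ys) μ'
  | opn {xs ys : List ℕ} {μ : Action} {x : Name} {y : ℕ} :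
      BinderStep xs μ ys (.out x (ch y)) → x ≠ ch y → BinderStep (y :: xs) μ ys (.bout x y)

/-- A transition of networks with label `μ`, together with the contributions of the components:
`act i` is the action of the component `i` (or `none`), `Q i` the result. The rule Cong is applied
on the right, to restore the form of a network. -/
def Step (P : Network k) (act : Fin k → Option Action) (μ : Action) (Q : Fin k → Proc)
    (P' : Network k) : Prop :=
  ∃ (μ₀ : Action) (new ys : List ℕ),
    BodyStep P.comp act μ₀ new Q ∧ BinderStep P.binders μ₀ ys μ ∧
      StructCong (Proc.resList (ys ++ new) (Proc.parAll Q)) P'.toProc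

/-- A computation of `P`, finite or infinite, with `length` steps; what the fields say about later
steps has no meaning. -/
structure Computation (P : Network k) where
  length : ℕ∞
  state : ℕ → Network k
  label : ℕ → Action
  act : ℕ → Fin k → Option Action
  result : ℕ → Fin k → Proc
  state_zero : state 0 = P
  step : ∀ m : ℕ, (m : ℕ∞) < length →
    (state m).Step (act m) (label m) (result m) (state (m + 1))

namespace Computation

variable {P : Network k}

/-- `C'` is equal to `C`, or extends `C`. -/
structure Extends (C C' : Computation P) : Prop where
  length_le : C.length ≤ C'.length
  state_eq : ∀ m : ℕ, (m : ℕ∞) ≤ C.length → C'.state m = C.state m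
  label_eq : ∀ m : ℕ, (m : ℕ∞) < C.length → C'.label m = C.label m
  act_eq : ∀ m : ℕ, (m : ℕ∞) < C.length → C'.act m = C.act m
  result_eq : ∀ m : ℕ, (m : ℕ∞) < C.length → C'.result m = C.result m

/-- The computation contains the action `μ`. -/
def Contains (C : Computation P) (μ : Action) : Prop :=
  ∃ m : ℕ, (m : ℕ∞) < C.length ∧ C.label m = μ

/-- The `m`-th step (`m < C.length`) of the projection of `C` over the component `i`: the
component, its action (`none` if the step is empty), the result. -/
def proj (C : Computation P) (i : Fin k) (m : ℕ) : Proc × Option Action × Proc :=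
  ((C.state m).comp i, C.act m i, C.result m i)

/-- The projection of `C` over the component `i` contains the action `μ`. -/
def ProjContains (C : Computation P) (i : Fin k) (μ : Action) : Prop :=
  ∃ m : ℕ, (m : ℕ∞) < C.length ∧ (C.proj i m).2.1 = some μ

end Computation

/-- Every computation extends to one in which all components announce the same leader `n` on the
channel `out`, and after which no other announcement is possible. -/
def IsElectoral (P : Network k) : Prop :=
  ∀ C : Computation P, ∃ C' : Computation P, C.Extends C' ∧ ∃ n : Fin k,
    (∀ i : Fin k, C'.ProjContains i (.out Name.out (Name.id n))) ∧
      ∀ C'' : Computation P, C'.Extends C'' →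
        ∀ m : Fin k, m ≠ n → ¬ C''.Contains (.out Name.out (Name.id m))

end Network

end PiCalc

/-! Whatever one component can do, every component in its orbit can do after renaming, so a
scheduler that serves the orbit in turn keeps the network symmetric. All orbits of the node
permutation have one size `p`. Moreover `p ≥ 2`: if every node were fixed, symmetry would force
every free name to be fixed, and the automorphism would be the identity. The action extends to a
permutation `π` of all names with `π ^ p = 1` (`rotation_namePerm`). It has free orbits of fresh
channels, so newly created names can be chosen symmetrically too.

The delicate case is a communication between two nodes of the same orbit, since each node then has
to perform both an output and an input during the round. With separate choice these two actions
cannot be rival branches of one sum. They come from parallel subterms and commute (`Tr.diamond`,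
`Act.diamond`), so the order in which a node is served does not matter. Hence each enabled
transition starts a round of `p` steps that ends in a balanced network (`round_move`, `round_com`).

If a reachable balanced network could announce `n` at node `i`, then node `σ i`, which has not
moved, could next announce `σ n ≠ n`. No electoral system allows this (`not_can_announce`). So
rounds in an electoral system contain no announcement, while the electoral property always supplies
a further transition from which to start a round. Iterating gives an infinite computation without
announcements, whose extensions contain none either: a contradiction (`not_isElectoral`).

The given transitions are closed under structural congruence and hard to invert. From them only the
enabled label is retained, through the syntactic predicate `Can` (`Trans.can`). A residual is then
rebuilt in the congruence-free late system `Tr`, where the diamond is proved, and returned to the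
early system by `Tr.trans_rename`. -/

namespace PiCalc

open Name

/-! ### Renaming -/

namespace Name

/-- Instantiates the bound name of a removed binder with `y` and renames the others by `f`. -/
def cons (y : Name) (f : Name → Name) : Name → Name
  | ch 0 => y
  | ch (n + 1) => f (ch n)
  | x => f x

/-- Exchanges the names bound by the two innermost binders. -/
def swap : Name → Name
  | ch 0 => ch 1
  | ch 1 => ch 0
  | x => x

theorem shift_injective : Function.Injective shift := by
  intro x y h
  cases x <;> cases y <;> simp_all [shift]

theorem shift_ne_zero (x : Name) : shift x ≠ ch 0 := by
  cases x <;> simp [shift]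

theorem eq_zero_or_shift (x : Name) : x = ch 0 ∨ ∃ y, x = shift y := by
  rcases x with _ | n | _ | n
  · exact .inr ⟨out, rfl⟩
  · exact .inr ⟨id n, rfl⟩
  · exact .inl rfl
  · exact .inr ⟨ch n, rfl⟩

@[simp] theorem cons_zero (y : Name) (f : Name → Name) : cons y f (ch 0) = y := rfl

@[simp] theorem cons_shift (y : Name) (f : Name → Name) (x : Name) :
    cons y f (shift x) = f x := by
  cases x <;> rfl

@[simp] theorem lift_zero (f : Name → Name) : lift f (ch 0) = ch 0 := rfl

@[simp] theorem lift_shift (f : Name → Name) (x : Name) : lift f (shift x) = shift (f x) := by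
  cases x <;> rfl

@[simp] theorem inst_zero (y : Name) : inst y (ch 0) = y := rfl

@[simp] theorem inst_shift (y x : Name) : inst y (shift x) = x := by
  cases x <;> rfl

@[simp] theorem swap_zero : swap (ch 0) = shift (ch 0) := rfl

@[simp] theorem swap_shift_zero : swap (shift (ch 0)) = ch 0 := rfl

@[simp] theorem swap_shift_shift (x : Name) : swap (shift (shift x)) = shift (shift x) := by
  cases x <;> rfl

@[simp] theorem bindName_self (c : ℕ) : bindName c (ch c) = ch 0 := by simp [bindName]

theorem bindName_of_ne {c : ℕ} {x : Name} (h : x ≠ ch c) : bindName c x = shift x := by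
  cases x <;> simp_all [bindName, shift]

/-- Two renamings of names under a binder are equal if they agree on the bound name and on the
names from outside. -/
theorem funext_bind {f g : Name → Name} (h0 : f (ch 0) = g (ch 0))
    (hs : ∀ x, f (shift x) = g (shift x)) : f = g := by
  funext x
  rcases eq_zero_or_shift x with rfl | ⟨y, rfl⟩
  · exact h0
  · exact hs y

theorem lift_comp (f g : Name → Name) : lift g ∘ lift f = lift (g ∘ f) :=
  funext_bind rfl (by simp)

@[simp] theorem lift_id : lift _root_.id = _root_.id := funext_bind rfl (by simp)

theorem lift_injective {f : Name → Name} (hf : Function.Injective f) :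
    Function.Injective (lift f) := by
  intro x y h
  rcases eq_zero_or_shift x with rfl | ⟨x, rfl⟩ <;> rcases eq_zero_or_shift y with rfl | ⟨y, rfl⟩
  · rfl
  · exact absurd h.symm (by simpa using shift_ne_zero _)
  · exact absurd h (by simpa using shift_ne_zero _)
  · simp only [lift_shift] at h
    rw [hf (shift_injective h)]

theorem exists_fresh (F : Finset Name) : ∃ c : ℕ, ch c ∉ F := by
  by_contra! h
  exact Set.infinite_of_injective_forall_mem (s := (F : Set Name)) (f := ch)
    (fun _ _ h => by simpa using h) (fun n => by simpa using h n) F.finite_toSet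

end Name

namespace Prefix

theorem mem_unbind {x : Name} {s : Finset Name} : x ∈ unbind s ↔ shift x ∈ s := by
  simp only [unbind, Finset.mem_image, Finset.mem_erase]
  constructor
  · rintro ⟨y, ⟨h0, hy⟩, rfl⟩
    rcases eq_zero_or_shift y with rfl | ⟨z, rfl⟩
    · exact absurd rfl h0
    · have : unshift (shift z) = z := by cases z <;> rfl
      rwa [this]
  · intro h
    exact ⟨_, ⟨shift_ne_zero x, h⟩, by cases x <;> rfl⟩

theorem under_comp (a : Prefix) (f g : Name → Name) :
    (a.rename f).under g ∘ a.under f = a.under (g ∘ f) := by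
  cases a <;> simp [under, rename, lift_comp]

@[simp] theorem under_id (a : Prefix) : a.under _root_.id = _root_.id := by
  cases a <;> simp [under]

theorem forall_mem_scope {a : Prefix} {s : Finset Name} {f g : Name → Name} :
    (∀ x ∈ a.scope s, f x = g x) ↔ ∀ x ∈ s, a.under f x = a.under g x := by
  cases a
  case inp =>
    simp only [scope, mem_unbind, under]
    constructor
    · intro h x hx
      rcases eq_zero_or_shift x with rfl | ⟨y, rfl⟩
      · rfl
      · simp [h y hx]
    · intro h x hx
      simpa using shift_injective (by simpa using h _ hx)
  all_goals rfl

theorem rename_eq_iff {a : Prefix} {f g : Name → Name} :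
    a.rename f = a.rename g ↔ ∀ x ∈ a.names, f x = g x := by
  cases a <;> simp [rename, names]

theorem scope_image (a : Prefix) (f : Name → Name) (s : Finset Name) :
    (a.rename f).scope (s.image (a.under f)) = (a.scope s).image f := by
  cases a
  case inp =>
    ext x
    simp only [rename, scope, mem_unbind, under, Finset.mem_image]
    constructor
    · rintro ⟨y, hy, h⟩
      rcases eq_zero_or_shift y with rfl | ⟨y, rfl⟩
      · exact absurd h.symm (shift_ne_zero x)
      · exact ⟨y, hy, shift_injective (by simpa using h)⟩
    · rintro ⟨y, hy, rfl⟩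
      exact ⟨_, hy, by simp⟩
  all_goals rfl

theorem names_image (a : Prefix) (f : Name → Name) : (a.rename f).names = a.names.image f := by
  cases a <;> simp [rename, names, Finset.image_insert]

theorem unbind_image (f : Name → Name) (s : Finset Name) :
    unbind (s.image (lift f)) = (unbind s).image f :=
  scope_image (.inp Name.out) f s

end Prefix

namespace Proc

/-- With de Bruijn indices, alpha-equivalence is equality, so a renamed term records the value of
the renaming at each free name. The forward direction is what lets symmetry of the components
determine the action on the edges. -/
theorem rename_eq_iff {P : Proc} {f g : Name → Name} :
    P.rename f = P.rename g ↔ ∀ x ∈ P.fn, f x = g x := by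
  induction P generalizing f g with
  | sum m pre cont ih =>
    simp only [rename, sum.injEq, heq_eq_eq, true_and, funext_iff, fn, Finset.mem_biUnion,
      Finset.mem_univ, Finset.mem_union, forall_exists_index, Prefix.rename_eq_iff]
    constructor
    · rintro ⟨h1, h2⟩ x i (hx | hx)
      · exact h1 i x hx
      · exact Prefix.forall_mem_scope.2 ((ih i).1 (h2 i)) x hx
    · intro h
      refine ⟨fun i x hx => h x i (.inl hx), fun i => (ih i).2 ?_⟩
      exact Prefix.forall_mem_scope.1 fun x hx => h x i (.inr hx)
  | nu P ih =>
    simp only [rename, nu.injEq, ih, fn]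
    exact (Prefix.forall_mem_scope (a := .inp Name.out)).symm
  | par P Q ihP ihQ =>
    simp only [rename, par.injEq, ihP, ihQ, fn, Finset.mem_union]
    exact ⟨fun h x hx => hx.elim (h.1 x) (h.2 x),
      fun h => ⟨fun x hx => h x (.inl hx), fun x hx => h x (.inr hx)⟩⟩
  | rep P ih => simp only [rename, rep.injEq, ih, fn]

theorem rename_congr {P : Proc} {f g : Name → Name} (h : ∀ x ∈ P.fn, f x = g x) :
    P.rename f = P.rename g :=
  rename_eq_iff.2 h

theorem rename_rename (P : Proc) (f g : Name → Name) :
    (P.rename f).rename g = P.rename (g ∘ f) := by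
  induction P generalizing f g with
  | sum m pre cont ih =>
    simp only [rename, ih, Prefix.under_comp]
    congr 1
    funext i
    cases pre i <;> rfl
  | nu P ih => simp only [rename, ih, lift_comp]
  | par P Q ihP ihQ => simp only [rename, ihP, ihQ]
  | rep P ih => simp only [rename, ih]

@[simp] theorem rename_id (P : Proc) : P.rename id = P := by
  induction P with
  | sum m pre cont ih =>
    simp only [rename, Prefix.under_id, ih]
    congr 1
    funext i
    cases pre i <;> rfl
  | nu P ih => simp only [rename, lift_id, ih]
  | par P Q ihP ihQ => simp only [rename, ihP, ihQ]
  | rep P ih => simp only [rename, ih]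

theorem fn_rename (P : Proc) (f : Name → Name) : (P.rename f).fn = P.fn.image f := by
  induction P generalizing f with
  | sum m pre cont ih =>
    simp only [rename, fn, ih, Prefix.scope_image, Prefix.names_image, Finset.biUnion_image,
      Finset.image_union]
  | nu P ih => simp only [rename, fn, ih, Prefix.unbind_image]
  | par P Q ihP ihQ => simp only [rename, fn, ihP, ihQ, Finset.image_union]
  | rep P ih => simp only [rename, fn, ih]

theorem separate_rename {P : Proc} (h : P.Separate) (f : Name → Name) :
    (P.rename f).Separate := by
  induction P generalizing f with
  | sum m pre cont ih =>
    refine ⟨h.1.imp (fun h i => ?_) (fun h i => ?_), fun i => ih i (h.2 i) _⟩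
    all_goals
      have := h i
      cases hi : pre i <;> simp_all [Prefix.rename, Prefix.IsInput, Prefix.IsOutput]
  | nu P ih => exact ih h _
  | par P Q ihP ihQ => exact ⟨ihP h.1 _, ihQ h.2 _⟩
  | rep P ih => exact ih h _

/-- A restriction can be given any fresh name. -/
theorem nu_rename_eq_res {P : Proc} {f : Name → Name} {c : ℕ}
    (h : ∀ x ∈ Prefix.unbind P.fn, f x ≠ ch c) :
    nu (P.rename (lift f)) = (P.rename (cons (ch c) f)).res c := by
  rw [res, rename_rename]
  congr 1
  refine rename_congr fun x hx => ?_
  rcases eq_zero_or_shift x with rfl | ⟨y, rfl⟩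
  · simp
  · simp [bindName_of_ne (h y (Prefix.mem_unbind.2 hx))]

end Proc

/-! ### A late transition system without structural congruence -/

/-- Labels of the late transitions: the parameter of an input and the object of a bound output
are bound in the residual. -/
inductive Label : Type
  | inp (x : Name) : Label
  | out (x y : Name) : Label
  | bout (x : Name) : Label
  | tau : Label

namespace Label

def map (f : Name → Name) : Label → Label
  | inp x => inp (f x)
  | out x y => out (f x) (f y)
  | bout x => bout (f x)
  | tau => tau

def names : Label → Finset Name
  | inp x => {x}
  | out x y => {x, y}
  | bout x => {x}
  | tau => ∅

/-- A name, as written in the residual. -/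
def wk : Label → Name → Name
  | inp _ => shift
  | bout _ => shift
  | _ => id

/-- Exchanges the binder of the label, if any, with the next binder of the residual. -/
def sw : Label → Name → Name
  | inp _ => swap
  | bout _ => swap
  | _ => id

/-- A renaming, as applied in the residual. -/
def lift (f : Name → Name) : Label → Name → Name
  | inp _ => Name.lift f
  | bout _ => Name.lift f
  | _ => f

def IsSend : Label → Prop
  | out _ _ => True
  | bout _ => True
  | _ => False

theorem map_map (ℓ : Label) (f g : Name → Name) : (ℓ.map f).map g = ℓ.map (g ∘ f) := by
  cases ℓ <;> rfl

theorem map_congr {ℓ : Label} {f g : Name → Name} (h : ∀ x ∈ ℓ.names, f x = g x) :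
    ℓ.map f = ℓ.map g := by
  cases ℓ <;> simp_all [map, names]

theorem mem_names_map {ℓ : Label} {f : Name → Name} {x : Name} :
    x ∈ (ℓ.map f).names ↔ ∃ y ∈ ℓ.names, f y = x := by
  cases ℓ <;> simp [map, names, eq_comm]

end Label

/-- Without a congruence rule, derivations can be inverted by cases on the process. De Bruijn
indices replace the freshness conditions: `map shift` keeps the restricted name out of the label,
`wk` makes room for the label's binder in an idle component, and `sw` restores the order of binders
when the restriction stays around the residual. -/
inductive Tr : Proc → Label → Proc → Prop
  | inpSum {m : ℕ} {pre : Fin m → Prefix} {P : Fin m → Proc} (j : Fin m) {x : Name} :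
      pre j = .inp x → Tr (.sum m pre P) (.inp x) (P j)
  | outSum {m : ℕ} {pre : Fin m → Prefix} {P : Fin m → Proc} (j : Fin m) {x y : Name} :
      pre j = .out x y → Tr (.sum m pre P) (.out x y) (P j)
  | tauSum {m : ℕ} {pre : Fin m → Prefix} {P : Fin m → Proc} (j : Fin m) :
      pre j = .tau → Tr (.sum m pre P) .tau (P j)
  | opn {P P' : Proc} {x : Name} :
      Tr P (.out (shift x) (ch 0)) P' → Tr (.nu P) (.bout x) P'
  | nu {P P' : Proc} {ℓ : Label} :
      Tr P (ℓ.map shift) P' → Tr (.nu P) ℓ (.nu (P'.rename ℓ.sw))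
  | parL {P P' Q : Proc} {ℓ : Label} :
      Tr P ℓ P' → Tr (.par P Q) ℓ (.par P' (Q.rename ℓ.wk))
  | parR {P Q Q' : Proc} {ℓ : Label} :
      Tr Q ℓ Q' → Tr (.par P Q) ℓ (.par (P.rename ℓ.wk) Q')
  | comL {P P' Q Q' : Proc} {x y : Name} :
      Tr P (.inp x) P' → Tr Q (.out x y) Q' → Tr (.par P Q) .tau (.par (P'.rename (inst y)) Q')
  | comR {P P' Q Q' : Proc} {x y : Name} :
      Tr P (.out x y) P' → Tr Q (.inp x) Q' → Tr (.par P Q) .tau (.par P' (Q'.rename (inst y)))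
  | closeL {P P' Q Q' : Proc} {x : Name} :
      Tr P (.inp x) P' → Tr Q (.bout x) Q' → Tr (.par P Q) .tau (.nu (.par P' Q'))
  | closeR {P P' Q Q' : Proc} {x : Name} :
      Tr P (.bout x) P' → Tr Q (.inp x) Q' → Tr (.par P Q) .tau (.nu (.par P' Q'))
  | rep {P P' : Proc} {ℓ : Label} :
      Tr (.par P (.rep P)) ℓ P' → Tr (.rep P) ℓ P'

namespace Tr

theorem rename {P Q : Proc} {ℓ : Label} (h : Tr P ℓ Q) (f : Name → Name) :
    Tr (P.rename f) (ℓ.map f) (Q.rename (ℓ.lift f)) := by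
  induction h generalizing f with
  | @inpSum m pre P j x h =>
    have := Tr.inpSum (P := fun i => (P i).rename ((pre i).under f))
      (pre := fun i => (pre i).rename f) j (x := f x) (by simp [h, Prefix.rename])
    rwa [h] at this
  | @outSum m pre P j x y h =>
    have := Tr.outSum (P := fun i => (P i).rename ((pre i).under f))
      (pre := fun i => (pre i).rename f) j (x := f x) (y := f y) (by simp [h, Prefix.rename])
    rwa [h] at this
  | @tauSum m pre P j h =>
    have := Tr.tauSum (P := fun i => (P i).rename ((pre i).under f))
      (pre := fun i => (pre i).rename f) j (by simp [h, Prefix.rename])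
    rwa [h] at this
  | opn _ ih =>
    have := ih (Name.lift f)
    simp only [Label.map, lift_shift, lift_zero] at this
    exact .opn this
  | @nu P P' ℓ _ ih =>
    have := ih (Name.lift f)
    rw [Label.map_map, show Name.lift f ∘ shift = shift ∘ f from funext (by simp),
      ← Label.map_map] at this
    have := Tr.nu this
    rw [Proc.rename_rename] at this
    simp only [Proc.rename, Proc.rename_rename]
    convert this using 3
    cases ℓ
    case inp | bout =>
      refine funext_bind ?_ fun x => ?_
      · simp [Label.lift, Label.sw, Label.map]
      · rcases eq_zero_or_shift x with rfl | ⟨x, rfl⟩ <;> simp [Label.lift, Label.sw, Label.map]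
    all_goals rfl
  | @parL P P' Q ℓ _ ih =>
    have := Tr.parL (Q := Q.rename f) (ih f)
    simp only [Proc.rename, Proc.rename_rename] at this ⊢
    convert this using 3
    cases ℓ <;> simp [Label.lift, Label.wk, Label.map, funext_iff]
  | @parR P Q Q' ℓ _ ih =>
    have := Tr.parR (P := P.rename f) (ih f)
    simp only [Proc.rename, Proc.rename_rename] at this ⊢
    convert this using 3
    cases ℓ <;> simp [Label.lift, Label.wk, Label.map, funext_iff]
  | @comL P P' Q Q' x y _ _ ih1 ih2 =>
    have := Tr.comL (ih1 f) (ih2 f)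
    simp only [Label.lift, Label.map, Proc.rename, Proc.rename_rename] at this ⊢
    rwa [show f ∘ inst y = inst (f y) ∘ Name.lift f from funext_bind (by simp) (by simp)]
  | @comR P P' Q Q' x y _ _ ih1 ih2 =>
    have := Tr.comR (ih1 f) (ih2 f)
    simp only [Label.lift, Label.map, Proc.rename, Proc.rename_rename] at this ⊢
    rwa [show f ∘ inst y = inst (f y) ∘ Name.lift f from funext_bind (by simp) (by simp)]
  | closeL _ _ ih1 ih2 => exact .closeL (ih1 f) (ih2 f)
  | closeR _ _ ih1 ih2 => exact .closeR (ih1 f) (ih2 f)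
  | rep _ ih => exact .rep (ih f)

theorem names_subset {P Q : Proc} {ℓ : Label} (h : Tr P ℓ Q) : ℓ.names ⊆ P.fn := by
  induction h with
  | inpSum j h | outSum j h | tauSum j h =>
    intro z hz
    simp only [Proc.fn, Finset.mem_biUnion]
    exact ⟨j, Finset.mem_univ j, Finset.mem_union_left _ (by rw [h]; exact hz)⟩
  | opn _ ih =>
    intro z hz
    rw [Label.names, Finset.mem_singleton] at hz
    subst hz
    exact Prefix.mem_unbind.2 (ih (by simp [Label.names]))
  | nu _ ih =>
    exact fun z hz => Prefix.mem_unbind.2 (ih (Label.mem_names_map.2 ⟨z, hz, rfl⟩))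
  | parL _ ih => exact ih.trans Finset.subset_union_left
  | parR _ ih => exact ih.trans Finset.subset_union_right
  | comL | comR | closeL | closeR => exact Finset.empty_subset _
  | rep _ ih => simpa [Proc.fn] using ih

/-- A transition brings in no free name except the one bound by its label; `wk` excludes that one.
-/
theorem mem_fn {P Q : Proc} {ℓ : Label} (h : Tr P ℓ Q) {z : Name} (hz : ℓ.wk z ∈ Q.fn) :
    z ∈ P.fn := by
  induction h generalizing z with
  | inpSum j h | outSum j h | tauSum j h =>
    simp only [Proc.fn, Finset.mem_biUnion]
    refine ⟨j, Finset.mem_univ j, Finset.mem_union_right _ ?_⟩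
    rw [h]
    first
      | exact Prefix.mem_unbind.2 hz
      | exact hz
  | opn _ ih => exact Prefix.mem_unbind.2 (ih hz)
  | @nu P P' ℓ _ ih =>
    refine Prefix.mem_unbind.2 (ih ?_)
    simp only [Proc.fn, Prefix.mem_unbind, Proc.fn_rename, Finset.mem_image] at hz
    obtain ⟨y, hy, h⟩ := hz
    cases ℓ
    case inp | bout =>
      simp only [Label.sw, Label.wk] at h
      rcases eq_zero_or_shift y with rfl | ⟨y, rfl⟩
      · have h : shift (ch 0) = shift (shift z) := h
        exact absurd (shift_injective h).symm (shift_ne_zero z)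
      · rcases eq_zero_or_shift y with rfl | ⟨y, rfl⟩
        · exact absurd h.symm (shift_ne_zero _)
        · rw [swap_shift_shift] at h
          rw [shift_injective (shift_injective h)] at hy
          exact hy
    all_goals
      simp only [Label.sw, Label.wk, id_eq] at h
      subst h
      exact hy
  | @parL P P' Q ℓ _ ih =>
    simp only [Proc.fn, Finset.mem_union, Proc.fn_rename, Finset.mem_image] at hz ⊢
    refine hz.imp ih ?_
    rintro ⟨y, hy, h⟩
    have : y = z := by
      cases ℓ
      case inp | bout => exact shift_injective h
      all_goals exact h
    rwa [← this]
  | @parR P Q Q' ℓ _ ih =>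
    simp only [Proc.fn, Finset.mem_union, Proc.fn_rename, Finset.mem_image] at hz ⊢
    refine hz.imp ?_ ih
    rintro ⟨y, hy, h⟩
    have : y = z := by
      cases ℓ
      case inp | bout => exact shift_injective h
      all_goals exact h
    rwa [← this]
  | @comL P P' Q Q' x y _ h2 ih1 ih2 =>
    simp only [Proc.fn, Finset.mem_union, Proc.fn_rename, Finset.mem_image, Label.wk, id_eq] at hz ⊢
    rcases hz with ⟨w, hw, h⟩ | hz
    · rcases eq_zero_or_shift w with rfl | ⟨w, rfl⟩
      · right
        rw [inst_zero] at h
        subst h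
        exact h2.names_subset (by simp [Label.names])
      · left
        rw [inst_shift] at h
        subst h
        exact ih1 hw
    · exact .inr (ih2 hz)
  | @comR P P' Q Q' x y h1 _ ih1 ih2 =>
    simp only [Proc.fn, Finset.mem_union, Proc.fn_rename, Finset.mem_image, Label.wk, id_eq] at hz ⊢
    rcases hz with hz | ⟨w, hw, h⟩
    · exact .inl (ih1 hz)
    · rcases eq_zero_or_shift w with rfl | ⟨w, rfl⟩
      · left
        rw [inst_zero] at h
        subst h
        exact h1.names_subset (by simp [Label.names])
      · right
        rw [inst_shift] at h
        subst h
        exact ih2 hw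
  | closeL _ _ ih1 ih2 | closeR _ _ ih1 ih2 =>
    simp only [Proc.fn, Finset.mem_union, Prefix.mem_unbind] at hz ⊢
    exact hz.imp ih1 ih2
  | rep _ ih => simpa [Proc.fn] using ih hz

theorem separate {P Q : Proc} {ℓ : Label} (h : Tr P ℓ Q) (hP : P.Separate) : Q.Separate := by
  induction h with
  | inpSum j h | outSum j h | tauSum j h => exact hP.2 j
  | opn _ ih => exact ih hP
  | nu _ ih => exact Proc.separate_rename (P := _) (ih hP) _
  | parL _ ih => exact ⟨ih hP.1, Proc.separate_rename hP.2 _⟩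
  | parR _ ih => exact ⟨Proc.separate_rename hP.1 _, ih hP.2⟩
  | comL _ _ ih1 ih2 => exact ⟨Proc.separate_rename (ih1 hP.1) _, ih2 hP.2⟩
  | comR _ _ ih1 ih2 => exact ⟨ih1 hP.1, Proc.separate_rename (ih2 hP.2) _⟩
  | closeL _ _ ih1 ih2 | closeR _ _ ih1 ih2 => exact ⟨ih1 hP.1, ih2 hP.2⟩
  | rep _ ih => exact ih ⟨hP, hP⟩

/-- In the separate-choice calculus an output and an input of the same process come from parallel
components, and therefore commute. -/
theorem diamond {P A B : Proc} {ℓ : Label} {z : Name} (hP : P.Separate) (hℓ : ℓ.IsSend)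
    (hA : Tr P ℓ A) (hB : Tr P (.inp z) B) :
    ∃ D, Tr A (.inp (ℓ.wk z)) D ∧ Tr B (ℓ.map shift) (D.rename ℓ.sw) := by
  induction hA generalizing z B with
  | inpSum | tauSum | comL | comR | closeL | closeR => exact hℓ.elim
  | @outSum m pre P j x y h =>
    obtain ⟨i, h'⟩ : ∃ i, pre i = .inp z := by
      cases hB with
      | inpSum i h' => exact ⟨i, h'⟩
    -- Separate choice enters the argument here: one sum cannot offer both the output and the input.
    rcases hP.1 with h0 | h0
    · exact absurd (h ▸ trivial) (h0 j)
    · exact absurd (h' ▸ trivial) (h0 i)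
  | @opn P A x _ ih =>
    cases hB with
    | @nu _ B' _ hB =>
      obtain ⟨D, h1, h2⟩ := ih hP trivial hB
      -- After the input, index 0 is its parameter and the name to be extruded is index 1; `swap`
      -- brings that name back to index 0, as `opn` requires.
      refine ⟨D, h1, .opn ?_⟩
      simpa [Label.map, Label.lift, Label.sw] using h2.rename swap
  | @nu P A ℓ _ ih =>
    cases hB with
    | @nu _ B' _ hB =>
      obtain ⟨D, h1, h2⟩ := ih hP (by cases ℓ <;> trivial) hB
      cases ℓ with
      | inp | tau => exact hℓ.elim
      | out x y =>
        refine ⟨.nu (D.rename swap), ?_, ?_⟩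
        · simpa [Label.map, Label.wk, Label.sw] using Tr.nu (ℓ := .inp z) h1
        · have := h2.rename swap
          simpa [Label.map, Label.lift, Label.sw] using
            Tr.nu (ℓ := .out (shift x) (shift y))
              (by simpa [Label.map, Label.lift, Label.sw] using this)
      | bout x =>
        -- Three binders are open: the input parameter, the extruded name and the restriction. The
        -- two swaps carry the restriction inward past both of the others.
        refine ⟨.nu ((D.rename (Name.lift swap)).rename swap), ?_, ?_⟩
        · have := h1.rename swap
          exact Tr.nu (ℓ := .inp (shift z))
            (by simpa [Label.map, Label.wk, Label.sw, Label.lift] using this)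
        · have := h2.rename swap
          have := Tr.nu (ℓ := .bout (shift x)) (by simpa [Label.map] using this)
          simp only [Label.map, Label.lift, Label.sw, Proc.rename, Proc.rename_rename] at this ⊢
          convert this using 3
          refine funext_bind (by simp) fun x => ?_
          rcases eq_zero_or_shift x with rfl | ⟨x, rfl⟩
          · simp
          · rcases eq_zero_or_shift x with rfl | ⟨x, rfl⟩ <;> simp
  | @parL P A Q ℓ hA ih =>
    cases hB with
    | @parL _ B _ _ hB =>
      obtain ⟨D, h1, h2⟩ := ih hP.1 hℓ hB
      refine ⟨_, .parL h1, ?_⟩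
      convert Tr.parL h2 using 1
      simp only [Proc.rename, Proc.rename_rename]
      congr 2
      cases ℓ <;> simp [Label.sw, Label.wk, Label.map, funext_iff]
    | @parR _ _ B _ hB =>
      refine ⟨_, .parR (hB.rename ℓ.wk), ?_⟩
      change Tr (.par (P.rename shift) B) _ _
      convert Tr.parL (hA.rename shift) using 1
      simp only [Proc.rename, Proc.rename_rename]
      congr 2
      · cases ℓ
        case bout =>
          refine funext_bind ?_ fun x => ?_ <;> simp [Label.sw, Label.wk, Label.lift]
        case out => rfl
        all_goals exact hℓ.elim
      · cases ℓ
        case bout =>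
          refine funext_bind ?_ fun x => ?_ <;> simp [Label.sw, Label.wk, Label.lift, Label.map]
        case out => simp [Label.sw, Label.wk, Label.lift, Label.map]
        all_goals exact hℓ.elim
  | @parR P Q A ℓ hA ih =>
    cases hB with
    | @parR _ _ B _ hB =>
      obtain ⟨D, h1, h2⟩ := ih hP.2 hℓ hB
      refine ⟨_, .parR h1, ?_⟩
      convert Tr.parR h2 using 1
      simp only [Proc.rename, Proc.rename_rename]
      congr 2
      cases ℓ <;> simp [Label.sw, Label.wk, Label.map, funext_iff]
    | @parL _ B _ _ hB =>
      refine ⟨_, .parL (hB.rename ℓ.wk), ?_⟩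
      change Tr (.par B (Q.rename shift)) _ _
      convert Tr.parR (hA.rename shift) using 1
      simp only [Proc.rename, Proc.rename_rename]
      congr 2
      · cases ℓ
        case bout =>
          refine funext_bind ?_ fun x => ?_ <;> simp [Label.sw, Label.wk, Label.lift, Label.map]
        case out => simp [Label.sw, Label.wk, Label.lift, Label.map]
        all_goals exact hℓ.elim
      · cases ℓ
        case bout =>
          refine funext_bind ?_ fun x => ?_ <;> simp [Label.sw, Label.wk, Label.lift]
        case out => rfl
        all_goals exact hℓ.elim
  | rep _ ih =>
    cases hB with
    | rep hB =>
      obtain ⟨D, h1, h2⟩ := ih ⟨hP, hP⟩ hℓ hB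
      exact ⟨D, h1, h2⟩

/-- The early transitions that correspond to a late one, for an instance of the process. -/
theorem trans_rename {P Q : Proc} {ℓ : Label} (h : Tr P ℓ Q) (f : Name → Name) :
    match ℓ with
    | .inp x => ∀ y, Trans (P.rename f) (.inp (f x) y) (Q.rename (cons y f))
    | .out x y => Trans (P.rename f) (.out (f x) (f y)) (Q.rename f)
    | .bout x => ∀ c, ch c ∉ (P.rename f).fn →
        Trans (P.rename f) (.bout (f x) c) (Q.rename (cons (ch c) f))
    | .tau => Trans (P.rename f) .tau (Q.rename f) := by
  -- An arbitrary renaming is needed because the early rules use named restrictions: going under a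
  -- binder replaces `f` by `cons (ch c) f` with `c` fresh.
  induction h generalizing f with
  | @inpSum m pre P j x h =>
    intro y
    have := Trans.inpSum (P := fun i => (P i).rename ((pre i).under f))
      (pre := fun i => (pre i).rename f) j (x := f x) y (by simp [h, Prefix.rename])
    rw [h, Proc.rename_rename] at this
    rwa [show inst y ∘ Prefix.under f (.inp x) = cons y f from
      funext_bind (by simp [Prefix.under]) (by simp [Prefix.under])] at this
  | @outSum m pre P j x y h =>
    have := Trans.outSum (P := fun i => (P i).rename ((pre i).under f))
      (pre := fun i => (pre i).rename f) j (x := f x) (y := f y) (by simp [h, Prefix.rename])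
    rwa [h] at this
  | @tauSum m pre P j h =>
    have := Trans.tauSum (P := fun i => (P i).rename ((pre i).under f))
      (pre := fun i => (pre i).rename f) j (by simp [h, Prefix.rename])
    rwa [h] at this
  | @opn P P' x h ih =>
    intro c hc
    have hx : shift x ∈ P.fn := h.names_subset (by simp [Label.names])
    simp only [Proc.fn_rename, Finset.mem_image, not_exists, not_and] at hc
    rw [Proc.rename, Proc.nu_rename_eq_res hc]
    have := ih (cons (ch c) f)
    simp only [cons_shift, cons_zero] at this
    exact .opn this (hc x (Prefix.mem_unbind.2 hx))
  | @nu P P' ℓ h ih =>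
    -- The free names of the residual may be seen from under the label's binder, the restriction, or
    -- both. One `c` is chosen to avoid all these readings.
    have key : ∀ F : Finset Name, ∃ c, ch c ∉ F ∧ (∀ x, shift x ∈ P.fn → f x ≠ ch c) ∧
        ∀ x, x ∈ P'.fn → f x ≠ ch c ∧ ∀ y, x = shift y → f y ≠ ch c ∧
          ∀ z, y = shift z → f z ≠ ch c := by
      intro F
      obtain ⟨c, hc⟩ := exists_fresh (F ∪ (Prefix.unbind P.fn).image f ∪ P'.fn.image f ∪
        (Prefix.unbind P'.fn).image f ∪ (Prefix.unbind (Prefix.unbind P'.fn)).image f)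
      simp only [Finset.mem_union, Finset.mem_image, Prefix.mem_unbind, not_or, not_exists,
        not_and] at hc
      refine ⟨c, hc.1.1.1.1, hc.1.1.1.2, fun x hx => ⟨hc.1.1.2 x hx, ?_⟩⟩
      rintro y rfl
      refine ⟨hc.1.2 y hx, ?_⟩
      rintro z rfl
      exact hc.2 z hx
    have hsub : ∀ x ∈ ℓ.names, shift x ∈ P.fn := fun x hx =>
      h.names_subset (Label.mem_names_map.2 ⟨x, hx, rfl⟩)
    cases ℓ with
    | inp x =>
      intro y
      obtain ⟨c, hcF, hcP, hcP'⟩ := key {y}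
      have := ih (cons (ch c) f) y
      simp only [cons_shift] at this
      simp only [Proc.rename]
      rw [Proc.nu_rename_eq_res fun x hx => hcP x (Prefix.mem_unbind.1 hx)]
      convert Trans.res (y := c) this ?_ using 1
      · simp only [Proc.res, Proc.rename_rename]
        congr 1
        refine Proc.rename_congr fun w hw => ?_
        rcases eq_zero_or_shift w with rfl | ⟨w, rfl⟩
        · simp [Label.sw, bindName_of_ne (show y ≠ ch c by simpa [eq_comm] using hcF)]
        · rcases eq_zero_or_shift w with rfl | ⟨w, rfl⟩
          · simp [Label.sw]
          · simp [Label.sw, bindName_of_ne (((hcP' _ hw).2 _ rfl).2 _ rfl)]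
      · simp only [Action.names, Finset.mem_insert, Finset.mem_singleton, not_or]
        exact ⟨(hcP x (hsub x (by simp [Label.names]))).symm, by simpa using hcF⟩
    | out x y =>
      obtain ⟨c, -, hcP, hcP'⟩ := key ∅
      have := ih (cons (ch c) f)
      change Trans _ (.out (cons _ _ (shift x)) (cons _ _ (shift y))) _ at this
      simp only [cons_shift] at this
      change Trans (.nu (P.rename _)) _ (.nu ((P'.rename _).rename _))
      rw [Proc.nu_rename_eq_res fun x hx => hcP x (Prefix.mem_unbind.1 hx)]
      convert Trans.res (y := c) this ?_ using 1
      · simp only [Proc.rename_rename]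
        exact Proc.nu_rename_eq_res fun w hw => ((hcP' _ (Prefix.mem_unbind.1 hw)).2 _ rfl).1
      · simp only [Action.names, Finset.mem_insert, Finset.mem_singleton, not_or]
        exact ⟨(hcP x (hsub x (by simp [Label.names]))).symm,
          (hcP y (hsub y (by simp [Label.names]))).symm⟩
    | bout x =>
      intro d hd
      obtain ⟨c, hcF, hcP, hcP'⟩ := key {ch d}
      have hdc : d ≠ c := by rintro rfl; simp at hcF
      simp only [Proc.rename] at hd ⊢
      rw [Proc.nu_rename_eq_res fun x hx => hcP x (Prefix.mem_unbind.1 hx)] at hd ⊢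
      have := ih (cons (ch c) f) d ?_
      · simp only [cons_shift] at this
        convert Trans.res (y := c) this ?_ using 1
        · simp only [Proc.res, Proc.rename_rename]
          congr 1
          refine Proc.rename_congr fun w hw => ?_
          rcases eq_zero_or_shift w with rfl | ⟨w, rfl⟩
          · simp [Label.sw, bindName_of_ne (show ch d ≠ ch c by simpa using hdc)]
          · rcases eq_zero_or_shift w with rfl | ⟨w, rfl⟩
            · simp [Label.sw]
            · simp [Label.sw, bindName_of_ne (((hcP' _ hw).2 _ rfl).2 _ rfl)]
        · simp only [Action.names, Finset.mem_insert, Finset.mem_singleton, not_or]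
          exact ⟨(hcP x (hsub x (by simp [Label.names]))).symm, by simpa [eq_comm] using hdc⟩
      · intro hmem
        refine hd ?_
        simp only [Proc.res, Proc.fn, Prefix.mem_unbind]
        rw [Proc.fn_rename, Finset.mem_image]
        exact ⟨ch d, hmem, bindName_of_ne (by simpa using hdc)⟩
    | tau =>
      obtain ⟨c, -, hcP, hcP'⟩ := key ∅
      have := ih (cons (ch c) f)
      change Trans (.nu (P.rename _)) _ (.nu ((P'.rename _).rename _))
      rw [Proc.nu_rename_eq_res fun x hx => hcP x (Prefix.mem_unbind.1 hx)]
      convert Trans.res (y := c) this (by simp [Action.names]) using 1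
      simp only [Proc.rename_rename]
      exact Proc.nu_rename_eq_res fun w hw => ((hcP' _ (Prefix.mem_unbind.1 hw)).2 _ rfl).1
  | @parL P P' Q ℓ _ ih =>
    have hwk : ∀ y, (Q.rename shift).rename (cons y f) = Q.rename f := fun y => by
      rw [Proc.rename_rename]
      congr 1
      funext x
      simp
    cases ℓ with
    | inp x =>
      intro y
      simp only [Proc.rename, Label.wk, hwk]
      exact .parL (ih f y) (by simp [Action.bn])
    | out x y =>
      simp only [Proc.rename, Label.wk, Proc.rename_id]
      exact .parL (ih f) (by simp [Action.bn])
    | bout x =>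
      intro c hc
      simp only [Proc.rename, Proc.fn, Finset.mem_union, not_or] at hc
      simp only [Proc.rename, Label.wk, hwk]
      exact .parL (ih f c hc.1) (by simpa [Action.bn] using hc.2)
    | tau =>
      simp only [Proc.rename, Label.wk, Proc.rename_id]
      exact .parL (ih f) (by simp [Action.bn])
  | @parR P Q Q' ℓ _ ih =>
    have hwk : ∀ y, (P.rename shift).rename (cons y f) = P.rename f := fun y => by
      rw [Proc.rename_rename]
      congr 1
      funext x
      simp
    cases ℓ with
    | inp x =>
      intro y
      simp only [Proc.rename, Label.wk, hwk]
      exact .parR (ih f y) (by simp [Action.bn])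
    | out x y =>
      simp only [Proc.rename, Label.wk, Proc.rename_id]
      exact .parR (ih f) (by simp [Action.bn])
    | bout x =>
      intro c hc
      simp only [Proc.rename, Proc.fn, Finset.mem_union, not_or] at hc
      simp only [Proc.rename, Label.wk, hwk]
      exact .parR (ih f c hc.2) (by simpa [Action.bn] using hc.1)
    | tau =>
      simp only [Proc.rename, Label.wk, Proc.rename_id]
      exact .parR (ih f) (by simp [Action.bn])
  | @comL P P' Q Q' x y _ _ ih1 ih2 =>
    have := Trans.comL (ih1 f (f y)) (ih2 f)
    simp only [Proc.rename, Proc.rename_rename]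
    rwa [show f ∘ inst y = cons (f y) f from funext_bind (by simp) (by simp)]
  | @comR P P' Q Q' x y _ _ ih1 ih2 =>
    have := Trans.comR (ih1 f) (ih2 f (f y))
    simp only [Proc.rename, Proc.rename_rename]
    rwa [show f ∘ inst y = cons (f y) f from funext_bind (by simp) (by simp)]
  | @closeL P P' Q Q' x _ _ ih1 ih2 =>
    obtain ⟨c, hc⟩ := exists_fresh ((P.rename f).fn ∪ (Q.rename f).fn ∪
      (Prefix.unbind (Proc.par P' Q').fn).image f)
    simp only [Finset.mem_union, not_or] at hc
    have := Trans.closeL (ih1 f (ch c)) (ih2 f c hc.1.2) hc.1.1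
    have h := Proc.nu_rename_eq_res (P := .par P' Q') (f := f) fun x hx h => hc.2 (Finset.mem_image.2 ⟨x, hx, h⟩)
    change Trans _ _ (((Proc.par P' Q').rename _).res c) at this
    rwa [← h] at this
  | @closeR P P' Q Q' x _ _ ih1 ih2 =>
    obtain ⟨c, hc⟩ := exists_fresh ((P.rename f).fn ∪ (Q.rename f).fn ∪
      (Prefix.unbind (Proc.par P' Q').fn).image f)
    simp only [Finset.mem_union, not_or] at hc
    have := Trans.closeR (ih1 f c hc.1.1) (ih2 f (ch c)) hc.1.2
    have h := Proc.nu_rename_eq_res (P := .par P' Q') (f := f) fun x hx h => hc.2 (Finset.mem_image.2 ⟨x, hx, h⟩)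
    change Trans _ _ (((Proc.par P' Q').rename _).res c) at this
    rwa [← h] at this
  | @rep P P' ℓ _ ih =>
    have := ih f
    cases ℓ with
    | inp x => exact fun y => .rep (this y)
    | out x y => exact .rep this
    | bout x => exact fun c hc => .rep (this c (by simpa [Proc.fn, Proc.rename] using hc))
    | tau => exact .rep this

end Tr

/-! ### Enabled labels -/

namespace Prefix

def label : Prefix → Label
  | inp x => .inp x
  | out x y => .out x y
  | tau => .tau

theorem label_rename (a : Prefix) (f : Name → Name) : (a.rename f).label = a.label.map f := by
  cases a <;> rfl

end Prefix

namespace Label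

/-- Some output on `x` is among the labels `S`. -/
def Sends (S : Label → Prop) (x : Name) : Prop := (∃ y, S (.out x y)) ∨ S (.bout x)

end Label

namespace Proc

/-- The process has a late transition with the given label. -/
def Can : Proc → Label → Prop
  | sum _ pre _, ℓ => ∃ j, (pre j).label = ℓ
  | nu P, ℓ => P.Can (ℓ.map shift) ∨ ∃ x, ℓ = .bout x ∧ P.Can (.out (shift x) (ch 0))
  | par P Q, ℓ => P.Can ℓ ∨ Q.Can ℓ ∨ ℓ = .tau ∧
      ∃ x, P.Can (.inp x) ∧ Label.Sends Q.Can x ∨ Label.Sends P.Can x ∧ Q.Can (.inp x)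
  | rep P, ℓ => P.Can ℓ ∨ ℓ = .tau ∧ ∃ x, P.Can (.inp x) ∧ Label.Sends P.Can x

theorem Can.exists_tr {P : Proc} {ℓ : Label} (h : P.Can ℓ) : ∃ Q, Tr P ℓ Q := by
  induction P generalizing ℓ with
  | sum m pre cont ih =>
    obtain ⟨j, hj⟩ := h
    refine ⟨cont j, ?_⟩
    cases h : pre j <;> rw [h] at hj <;> subst hj
    · exact .inpSum j h
    · exact .outSum j h
    · exact .tauSum j h
  | nu P ih =>
    rcases h with h | ⟨x, rfl, h⟩
    · obtain ⟨Q, h⟩ := ih h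
      exact ⟨_, .nu h⟩
    · obtain ⟨Q, h⟩ := ih h
      exact ⟨_, .opn h⟩
  | par P Q ihP ihQ =>
    rcases h with h | h | ⟨rfl, x, ⟨h1, ⟨y, h2⟩ | h2⟩ | ⟨⟨y, h1⟩ | h1, h2⟩⟩
    · obtain ⟨_, h⟩ := ihP h
      exact ⟨_, .parL h⟩
    · obtain ⟨_, h⟩ := ihQ h
      exact ⟨_, .parR h⟩
    · obtain ⟨_, h1⟩ := ihP h1
      obtain ⟨_, h2⟩ := ihQ h2
      exact ⟨_, .comL h1 h2⟩
    · obtain ⟨_, h1⟩ := ihP h1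
      obtain ⟨_, h2⟩ := ihQ h2
      exact ⟨_, .closeL h1 h2⟩
    · obtain ⟨_, h1⟩ := ihP h1
      obtain ⟨_, h2⟩ := ihQ h2
      exact ⟨_, .comR h1 h2⟩
    · obtain ⟨_, h1⟩ := ihP h1
      obtain ⟨_, h2⟩ := ihQ h2
      exact ⟨_, .closeR h1 h2⟩
  | rep P ih =>
    rcases h with h | ⟨rfl, x, h1, ⟨y, h2⟩ | h2⟩
    · obtain ⟨_, h⟩ := ih h
      exact ⟨_, .rep (.parL h)⟩
    · obtain ⟨_, h1⟩ := ih h1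
      obtain ⟨_, h2⟩ := ih h2
      exact ⟨_, .rep (.comL h1 (.rep (.parL h2)))⟩
    · obtain ⟨_, h1⟩ := ih h1
      obtain ⟨_, h2⟩ := ih h2
      exact ⟨_, .rep (.closeL h1 (.rep (.parL h2)))⟩

theorem Can.rename {P : Proc} {ℓ : Label} (h : P.Can ℓ) (f : Name → Name) :
    (P.rename f).Can (ℓ.map f) := by
  induction P generalizing ℓ f with
  | sum m pre cont ih =>
    obtain ⟨j, rfl⟩ := h
    exact ⟨j, (pre j).label_rename f⟩
  | nu P ih =>
    rcases h with h | ⟨x, rfl, h⟩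
    · left
      have := ih h (lift f)
      rwa [Label.map_map, show lift f ∘ shift = shift ∘ f from funext (by simp),
        ← Label.map_map] at this
    · exact .inr ⟨f x, rfl, by simpa [Label.map] using ih h (lift f)⟩
  | par P Q ihP ihQ =>
    rcases h with h | h | ⟨rfl, x, ⟨h1, h2⟩ | ⟨h1, h2⟩⟩
    · exact .inl (ihP h f)
    · exact .inr (.inl (ihQ h f))
    · exact .inr (.inr ⟨rfl, f x, .inl ⟨ihP h1 f,
        h2.imp (fun ⟨y, h⟩ => ⟨f y, ihQ h f⟩) (ihQ (ℓ := .bout x) · f)⟩⟩)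
    · exact .inr (.inr ⟨rfl, f x, .inr
        ⟨h1.imp (fun ⟨y, h⟩ => ⟨f y, ihP h f⟩) (ihP (ℓ := .bout x) · f), ihQ h2 f⟩⟩)
  | rep P ih =>
    rcases h with h | ⟨rfl, x, h1, h2⟩
    · exact .inl (ih h f)
    · exact .inr ⟨rfl, f x, ih h1 f, h2.imp (fun ⟨y, h⟩ => ⟨f y, ih h f⟩) (ih (ℓ := .bout x) · f)⟩

theorem shift_eq_lift {f : Name → Name} {x y : Name} (h : shift x = lift f y) :
    ∃ z, y = shift z ∧ x = f z := by
  rcases eq_zero_or_shift y with rfl | ⟨z, rfl⟩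
  · exact absurd h (shift_ne_zero x)
  · exact ⟨z, rfl, shift_injective (by simpa using h)⟩

/-- Injectivity matters because identifying two channels could enable a communication that `P` does
not have. -/
theorem Can.of_rename {P : Proc} {ℓ : Label} {f : Name → Name} (hf : Function.Injective f)
    (h : (P.rename f).Can ℓ) : ∃ ℓ', P.Can ℓ' ∧ ℓ = ℓ'.map f := by
  induction P generalizing ℓ f with
  | sum m pre cont ih =>
    obtain ⟨j, rfl⟩ := h
    exact ⟨(pre j).label, ⟨j, rfl⟩, (pre j).label_rename f⟩
  | nu P ih =>
    rcases h with h | ⟨x, rfl, h⟩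
    · obtain ⟨ℓ', h', e⟩ := ih (lift_injective hf) h
      cases ℓ <;> cases ℓ' <;> simp only [Label.map, Label.inp.injEq, Label.out.injEq,
        Label.bout.injEq, reduceCtorEq] at e
      · obtain ⟨z, rfl, rfl⟩ := shift_eq_lift e
        exact ⟨.inp z, .inl h', rfl⟩
      · obtain ⟨z, rfl, rfl⟩ := shift_eq_lift e.1
        obtain ⟨w, rfl, rfl⟩ := shift_eq_lift e.2
        exact ⟨.out z w, .inl h', rfl⟩
      · obtain ⟨z, rfl, rfl⟩ := shift_eq_lift e
        exact ⟨.bout z, .inl h', rfl⟩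
      · exact ⟨.tau, .inl h', rfl⟩
    · obtain ⟨ℓ', h', e⟩ := ih (lift_injective hf) h
      cases ℓ' <;> simp only [Label.map, Label.out.injEq, reduceCtorEq] at e
      obtain ⟨z, rfl, rfl⟩ := shift_eq_lift e.1
      obtain rfl := lift_injective hf (show lift f _ = lift f (ch 0) from e.2.symm)
      exact ⟨.bout z, .inr ⟨z, rfl, h'⟩, rfl⟩
  | par P Q ihP ihQ =>
    have inp : ∀ {R : Proc} {x}, (∃ ℓ', R.Can ℓ' ∧ Label.inp x = ℓ'.map f) →
        ∃ z, R.Can (.inp z) ∧ x = f z := by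
      rintro R x ⟨ℓ', h, e⟩
      cases ℓ' <;> simp only [Label.map, Label.inp.injEq, reduceCtorEq] at e
      exact ⟨_, h, e⟩
    have send : ∀ {R : Proc} {x}, (∀ {ℓ}, (R.rename f).Can ℓ → ∃ ℓ', R.Can ℓ' ∧ ℓ = ℓ'.map f) →
        Label.Sends (R.rename f).Can x → ∃ z, Label.Sends R.Can z ∧ x = f z := by
      rintro R x ih (⟨y, h⟩ | h)
      all_goals
        obtain ⟨ℓ', h, e⟩ := ih h
        cases ℓ' <;> simp only [Label.map, Label.out.injEq, Label.bout.injEq, reduceCtorEq] at e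
      · exact ⟨_, .inl ⟨_, h⟩, e.1⟩
      · exact ⟨_, .inr h, e⟩
    rcases h with h | h | ⟨rfl, x, ⟨h1, h2⟩ | ⟨h1, h2⟩⟩
    · obtain ⟨ℓ', h, e⟩ := ihP hf h
      exact ⟨ℓ', .inl h, e⟩
    · obtain ⟨ℓ', h, e⟩ := ihQ hf h
      exact ⟨ℓ', .inr (.inl h), e⟩
    · obtain ⟨z, h1', rfl⟩ := inp (ihP hf h1)
      obtain ⟨w, h2, e⟩ := send (ihQ hf) h2
      exact ⟨.tau, .inr (.inr ⟨rfl, z, .inl ⟨h1', hf e ▸ h2⟩⟩), rfl⟩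
    · obtain ⟨z, h1', rfl⟩ := send (ihP hf) h1
      obtain ⟨w, h2, e⟩ := inp (ihQ hf h2)
      exact ⟨.tau, .inr (.inr ⟨rfl, z, .inr ⟨h1', hf e ▸ h2⟩⟩), rfl⟩
  | rep P ih =>
    rcases h with h | ⟨rfl, x, h1, h2⟩
    · obtain ⟨ℓ', h, e⟩ := ih hf h
      exact ⟨ℓ', .inl h, e⟩
    · obtain ⟨ℓ', h1', e1⟩ := ih hf h1
      cases ℓ' <;> simp only [Label.map, Label.inp.injEq, reduceCtorEq] at e1
      subst e1
      refine ⟨.tau, .inr ⟨rfl, _, h1', ?_⟩, rfl⟩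
      rcases h2 with ⟨y, h⟩ | h
      all_goals
        obtain ⟨ℓ', h, e⟩ := ih hf h
        cases ℓ' <;> simp only [Label.map, Label.out.injEq, Label.bout.injEq, reduceCtorEq] at e
      · exact .inl ⟨_, hf e.1 ▸ h⟩
      · exact .inr (hf e ▸ h)

theorem can_rename_shift {P : Proc} {ℓ : Label} :
    (P.rename shift).Can (ℓ.map shift) ↔ P.Can ℓ := by
  refine ⟨fun h => ?_, fun h => h.rename shift⟩
  obtain ⟨ℓ', h, e⟩ := h.of_rename shift_injective
  cases ℓ <;> cases ℓ' <;> simp only [Label.map, Label.inp.injEq, Label.out.injEq,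
    Label.bout.injEq, reduceCtorEq, shift_injective.eq_iff] at e
  · exact e ▸ h
  · exact e.1 ▸ e.2 ▸ h
  · exact e ▸ h
  · exact h

theorem sends_rename_shift {P : Proc} {x : Name} :
    Label.Sends (P.rename shift).Can (shift x) ↔ Label.Sends P.Can x := by
  constructor
  · rintro (⟨y, h⟩ | h)
    · obtain ⟨ℓ', h, e⟩ := h.of_rename shift_injective
      cases ℓ' <;> simp only [Label.map, Label.out.injEq, reduceCtorEq] at e
      exact .inl ⟨_, shift_injective e.1 ▸ h⟩
    · exact .inr (can_rename_shift.1 h)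
  · exact Or.imp (fun ⟨y, h⟩ => ⟨shift y, h.rename shift⟩) fun h => h.rename shift

/-- A restriction may turn a free output into a bound one. `Sends` ignores the difference, so it is
stable under restriction, and Com and Close can be treated together. -/
theorem sends_nu {P : Proc} {x : Name} :
    Label.Sends (nu P).Can x ↔ Label.Sends P.Can (shift x) := by
  constructor
  · rintro (⟨y, h | ⟨_, h, _⟩⟩ | h | ⟨y, h, h'⟩)
    · exact .inl ⟨_, h⟩
    · cases h
    · exact .inr h
    · cases h
      exact .inl ⟨_, h'⟩
  · rintro (⟨y, h⟩ | h)
    · rcases eq_zero_or_shift y with rfl | ⟨y, rfl⟩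
      · exact .inr (.inr ⟨x, rfl, h⟩)
      · exact .inl ⟨y, .inl h⟩
    · exact .inr (.inl h)

/-- The shifted `Q` does not mention the restricted name, so it neither extrudes that name nor
communicates on it. A Close on the left corresponds to a Com under the restriction on the right when
the object is the restricted name. -/
theorem can_scope {P Q : Proc} {ℓ : Label} :
    (par (nu P) Q).Can ℓ ↔ (nu (par P (Q.rename shift))).Can ℓ := by
  have hinp : ∀ {R : Proc} {x}, (nu R).Can (.inp x) ↔ R.Can (.inp (shift x)) := by
    simp [Can, Label.map]
  have hz : ∀ {x y}, (Q.rename shift).Can (.out x y) → y ≠ ch 0 := by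
    rintro x y h rfl
    obtain ⟨ℓ', -, e⟩ := h.of_rename shift_injective
    cases ℓ' <;> simp only [Label.map, Label.out.injEq, reduceCtorEq] at e
    exact shift_ne_zero _ e.2.symm
  have hr : ∀ {x}, (Q.rename shift).Can (.inp x) ∨ Label.Sends (Q.rename shift).Can x →
      ∃ y, x = shift y := by
    rintro x (h | ⟨y, h⟩ | h)
    all_goals
      obtain ⟨ℓ', -, e⟩ := h.of_rename shift_injective
      cases ℓ' <;> simp only [Label.map, Label.out.injEq, Label.bout.injEq, Label.inp.injEq,
        reduceCtorEq] at e
    · exact ⟨_, e⟩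
    · exact ⟨_, e.1⟩
    · exact ⟨_, e⟩
  constructor
  · rintro ((h | ⟨x, rfl, h⟩) | h | ⟨rfl, x, ⟨h1, h2⟩ | ⟨h1, h2⟩⟩)
    · exact .inl (.inl h)
    · exact .inr ⟨x, rfl, .inl h⟩
    · exact .inl (.inr (.inl (can_rename_shift.2 h)))
    · exact .inl (.inr (.inr ⟨rfl, shift x, .inl ⟨hinp.1 h1, sends_rename_shift.2 h2⟩⟩))
    · exact .inl (.inr (.inr ⟨rfl, shift x, .inr ⟨sends_nu.1 h1, h2.rename shift⟩⟩))
  · rintro ((h | h | ⟨h, x, ⟨h1, h2⟩ | ⟨h1, h2⟩⟩) | ⟨x, rfl, h | h | ⟨h, -⟩⟩)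
    · exact .inl (.inl h)
    · exact .inr (.inl (can_rename_shift.1 h))
    · obtain ⟨x, rfl⟩ := hr (.inr h2)
      exact .inr (.inr ⟨by cases ℓ <;> trivial, x, .inl ⟨hinp.2 h1, sends_rename_shift.1 h2⟩⟩)
    · obtain ⟨x, rfl⟩ := hr (.inl h2)
      exact .inr (.inr ⟨by cases ℓ <;> trivial, x, .inr
        ⟨sends_nu.2 h1, can_rename_shift (ℓ := .inp x).1 h2⟩⟩)
    · exact .inl (.inr ⟨x, rfl, h⟩)
    · exact absurd rfl (hz h)
    · cases h

end Proc

/-- `Can` is computed from the syntax, so the congruence rules are rewriting and only scope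
expansion needs an argument. This disposes of the rule Cong. -/
theorem StructCong.can_eq {P Q : Proc} (h : StructCong P Q) : P.Can = Q.Can := by
  induction h with
  | refl => rfl
  | symm _ ih => exact ih.symm
  | trans _ _ ih1 ih2 => exact ih1.trans ih2
  | sum _ _ => rfl
  | nu _ ih => funext ℓ; simp only [Proc.Can, ih]
  | par _ _ ih1 ih2 => funext ℓ; simp only [Proc.Can, ih1, ih2]
  | rep _ ih => funext ℓ; simp only [Proc.Can, ih]
  | @scope P Q x h =>
    funext ℓ
    have : Q.rename (bindName x) = Q.rename shift :=
      Proc.rename_congr fun z hz => bindName_of_ne fun e => h (e ▸ hz)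
    simp only [Proc.res, Proc.rename, this]
    exact propext Proc.can_scope

namespace Action

def label : Action → Label
  | inp x _ => .inp x
  | out x y => .out x y
  | bout x _ => .bout x
  | tau => .tau

theorem label_names_subset (μ : Action) : μ.label.names ⊆ μ.names := by
  cases μ <;> simp [label, names, Label.names]

end Action

/-- The transitions respect the structural congruence as far as enabledness is concerned. -/
theorem Trans.can {P Q : Proc} {μ : Action} (h : Trans P μ Q) : P.Can μ.label := by
  induction h with
  | inpSum j _ h | outSum j h | tauSum j h => exact ⟨j, by rw [h]; rfl⟩
  | @opn P P' x y _ hx ih =>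
    refine .inr ⟨x, rfl, ?_⟩
    simpa [Action.label, Label.map, bindName_of_ne hx] using ih.rename (bindName y)
  | @res P P' μ y _ hy ih =>
    left
    rw [← Label.map_congr (f := bindName y) fun z hz => bindName_of_ne ?_]
    · exact ih.rename _
    · rintro rfl
      exact hy (μ.label_names_subset hz)
  | parL _ _ ih => exact .inl ih
  | parR _ _ ih => exact .inr (.inl ih)
  | comL _ _ ih1 ih2 => exact .inr (.inr ⟨rfl, _, .inl ⟨ih1, .inl ⟨_, ih2⟩⟩⟩)
  | comR _ _ ih1 ih2 => exact .inr (.inr ⟨rfl, _, .inr ⟨.inl ⟨_, ih1⟩, ih2⟩⟩)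
  | closeL _ _ _ ih1 ih2 => exact .inr (.inr ⟨rfl, _, .inl ⟨ih1, .inr ih2⟩⟩)
  | closeR _ _ _ ih1 ih2 => exact .inr (.inr ⟨rfl, _, .inr ⟨.inr ih1, ih2⟩⟩)
  | @rep P P' μ _ ih =>
    -- The visible actions of a replication are those of a single copy, so a communication between
    -- `P` and `!P` is one between two copies of `P`.
    have hinp : ∀ {x}, (Proc.rep P).Can (.inp x) → P.Can (.inp x) := by simp [Proc.Can]
    have hsend : ∀ {x}, Label.Sends (Proc.rep P).Can x → Label.Sends P.Can x := by
      simp [Proc.Can, Label.Sends]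
    rcases ih with h | h | ⟨h, x, ⟨h1, h2⟩ | ⟨h1, h2⟩⟩
    · exact .inl h
    · exact h
    · exact .inr ⟨h, x, h1, hsend h2⟩
    · exact .inr ⟨h, x, hinp h2, h1⟩
  | cong h1 _ _ ih => rw [h1.can_eq]; exact ih

/-! ### Early transitions without structural congruence -/

namespace Action

/-- The names that are received from, or created for, the environment. -/
def objects : Action → Finset Name
  | inp _ y => {y}
  | bout _ y => {ch y}
  | _ => ∅

def IsSend : Action → Prop
  | out _ _ => True
  | bout _ _ => True
  | _ => False

/-- The renaming of an action; it has a meaning if bound names are renamed to names `ch n`. -/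
def map (f : Name → Name) : Action → Action
  | inp x y => inp (f x) (f y)
  | out x y => out (f x) (f y)
  | bout x y => bout (f x) (match f (ch y) with | ch n => n | _ => 0)
  | tau => tau

end Action

/-- The binder of a late label is instantiated by a concrete object; for a bound output this object
must be fresh for `P`. -/
def Act (P : Proc) : Action → Proc → Prop
  | .inp x y, Q => ∃ R, Tr P (.inp x) R ∧ Q = R.rename (inst y)
  | .out x y, Q => Tr P (.out x y) Q
  | .bout x y, Q => ch y ∉ P.fn ∧ ∃ R, Tr P (.bout x) R ∧ Q = R.rename (inst (ch y))
  | .tau, Q => Tr P .tau Q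

theorem Proc.Can.exists_act {P : Proc} {μ : Action} (h : P.Can μ.label)
    (hb : Disjoint μ.bn P.fn) : ∃ Q, Act P μ Q := by
  obtain ⟨Q, h⟩ := h.exists_tr
  cases μ with
  | inp x y => exact ⟨_, Q, h, rfl⟩
  | out x y => exact ⟨_, h⟩
  | bout x y => exact ⟨_, by simpa [Action.bn] using hb, Q, h, rfl⟩
  | tau => exact ⟨_, h⟩

namespace Act

theorem trans {P Q : Proc} {μ : Action} (h : Act P μ Q) : Trans P μ Q := by
  have hc : ∀ y, cons y id = inst y := fun y => funext_bind (by simp) (by simp)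
  cases μ with
  | inp x y =>
    obtain ⟨R, h, rfl⟩ := h
    simpa [hc] using h.trans_rename _root_.id y
  | out x y => simpa using Tr.trans_rename h _root_.id
  | bout x y =>
    obtain ⟨hy, R, h, rfl⟩ := h
    simpa [hc] using h.trans_rename _root_.id y (by simpa using hy)
  | tau => simpa using Tr.trans_rename h _root_.id

/-- Injectivity preserves the freshness of an extruded name, and `hb` keeps the default value in
`Action.map` from being used. -/
theorem rename {P Q : Proc} {μ : Action} (h : Act P μ Q) {f : Name → Name}
    (hf : Function.Injective f) (hb : ∀ z ∈ μ.bn, ∃ n, f z = ch n) :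
    Act (P.rename f) (μ.map f) (Q.rename f) := by
  have key : ∀ (R : Proc) y, (R.rename (inst y)).rename f =
      (R.rename (lift f)).rename (inst (f y)) := fun R y => by
    simp only [Proc.rename_rename]
    congr 1
    exact funext_bind (by simp) (by simp)
  cases μ with
  | inp x y =>
    obtain ⟨R, h, rfl⟩ := h
    exact ⟨_, h.rename f, key R y⟩
  | out x y => exact Tr.rename h f
  | bout x y =>
    obtain ⟨hy, R, h, rfl⟩ := h
    obtain ⟨n, hn⟩ := hb (ch y) (by simp [Action.bn])
    simp only [Action.map, hn]
    refine ⟨?_, _, h.rename f, by rw [key, hn]; rfl⟩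
    rw [Proc.fn_rename, ← hn]
    simpa [hf.eq_iff] using hy
  | tau => exact Tr.rename h f

theorem separate {P Q : Proc} {μ : Action} (h : Act P μ Q) (hP : P.Separate) : Q.Separate := by
  cases μ with
  | inp x y =>
    obtain ⟨R, h, rfl⟩ := h
    exact Proc.separate_rename (h.separate hP) _
  | out x y => exact Tr.separate h hP
  | bout x y =>
    obtain ⟨-, R, h, rfl⟩ := h
    exact Proc.separate_rename (h.separate hP) _
  | tau => exact Tr.separate h hP

theorem fn_subset {P Q : Proc} {μ : Action} (h : Act P μ Q) : Q.fn ⊆ P.fn ∪ μ.objects := by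
  have key : ∀ {R : Proc} {ℓ : Label}, Tr P ℓ R → ℓ.wk = shift → ∀ y,
      (R.rename (inst y)).fn ⊆ P.fn ∪ {y} := by
    intro R ℓ h hℓ y z hz
    rw [Proc.fn_rename, Finset.mem_image] at hz
    obtain ⟨w, hw, rfl⟩ := hz
    rcases eq_zero_or_shift w with rfl | ⟨w, rfl⟩
    · simp
    · rw [inst_shift]
      exact Finset.mem_union_left _ (h.mem_fn (by rwa [hℓ]))
  cases μ with
  | inp x y =>
    obtain ⟨R, h, rfl⟩ := h
    exact key h rfl y
  | out x y => exact fun z hz => Finset.mem_union_left _ (Tr.mem_fn h hz)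
  | bout x y =>
    obtain ⟨-, R, h, rfl⟩ := h
    exact key h rfl (ch y)
  | tau => exact fun z hz => Finset.mem_union_left _ (Tr.mem_fn h hz)

/-- The condition on `w` is needed because a process that has received `w` may contain it free, and
then could no longer extrude a name under that identity. -/
theorem diamond {P A B : Proc} {o : Action} {z w : Name} (hP : P.Separate) (ho : o.IsSend)
    (hA : Act P o A) (hB : Act P (.inp z w) B) (hw : w ∉ o.bn) :
    ∃ D, Act A (.inp z w) D ∧ Act B o D := by
  have hfn := hB.fn_subset
  obtain ⟨B, hB, rfl⟩ := hB
  cases o with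
  | inp | tau => exact ho.elim
  | out x y =>
    obtain ⟨D, h1, h2⟩ := Tr.diamond (ℓ := .out x y) hP trivial hA hB
    exact ⟨_, ⟨D, h1, rfl⟩, by
      simpa [Act, Label.map, Label.lift, Label.sw] using h2.rename (inst w)⟩
  | bout x c =>
    obtain ⟨hc, A, hA, rfl⟩ := hA
    obtain ⟨D, h1, h2⟩ := hA.diamond (ℓ := .bout x) hP trivial hB
    have h1 := h1.rename (inst (ch c))
    have h2 := h2.rename (inst w)
    simp only [Label.map, Label.wk, inst_shift] at h1 h2
    refine ⟨_, ⟨_, h1, rfl⟩, ?_, _, h2, ?_⟩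
    · intro h
      have := hfn h
      simp_all [Action.bn, Action.objects, eq_comm]
    · simp only [Label.lift, Label.sw, Proc.rename_rename]
      congr 1
      refine funext_bind (by simp) fun x => ?_
      rcases eq_zero_or_shift x with rfl | ⟨x, rfl⟩ <;> simp

end Act

/-! ### Steps of networks -/

namespace Action

def subject : Action → Finset Name
  | inp x _ => {x}
  | out x _ => {x}
  | bout x _ => {x}
  | tau => ∅

theorem subject_subset (μ : Action) : μ.subject ⊆ μ.names := by
  cases μ <;> simp [subject, names]

end Action

namespace Network

variable {k : ℕ}

/-- Open changes only the status of the object, and both rules forbid the restricted name as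
subject. -/
theorem BinderStep.subject {xs ys : List ℕ} {μ μ' : Action} (h : BinderStep xs μ ys μ') :
    μ'.subject = μ.subject ∧ ∀ b ∈ xs, ch b ∉ μ.subject := by
  induction h with
  | nil => simp
  | @res xs ys μ μ' y _ hy ih =>
    refine ⟨ih.1, ?_⟩
    simp only [List.mem_cons, forall_eq_or_imp]
    exact ⟨fun h => hy (μ'.subject_subset (ih.1 ▸ h)), ih.2⟩
  | @opn xs ys μ x y _ hx ih =>
    refine ⟨ih.1, ?_⟩
    simp only [List.mem_cons, forall_eq_or_imp]
    refine ⟨fun h => hx ?_, ih.2⟩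
    rw [← ih.1] at h
    simpa [Action.subject, eq_comm] using h

/-- The only binder that an action may mention is the object of a free output. Open removes it;
every other binder remains by Res. -/
theorem exists_binderStep {xs : List ℕ} (hxs : xs.Nodup) {μ : Action}
    (h : ∀ b ∈ xs, ch b ∈ μ.names → ∃ x, μ = .out x (ch b) ∧ x ≠ ch b) :
    ∃ ys μ', BinderStep xs μ ys μ' ∧ ys.Nodup ∧
      (∀ b, b ∈ ys ↔ b ∈ xs ∧ ∀ x, μ ≠ .out x (ch b)) ∧
      (μ' = μ ∨ ∃ x, ∃ b ∈ xs, μ = .out x (ch b) ∧ μ' = .bout x b) := by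
  induction xs with
  | nil => exact ⟨[], μ, .nil μ, List.nodup_nil, by simp, .inl rfl⟩
  | cons y xs ih =>
    obtain ⟨hy, hxs⟩ := List.nodup_cons.1 hxs
    simp only [List.mem_cons, forall_eq_or_imp] at h
    obtain ⟨ys, μ', hstep, hys, hmem, h'⟩ := ih hxs h.2
    have hyy : y ∉ ys := fun h => hy ((hmem y).1 h).1
    have close : ch y ∉ μ'.names → (∀ x, μ ≠ .out x (ch y)) → ∃ ys μ',
        BinderStep (y :: xs) μ ys μ' ∧ ys.Nodup ∧
        (∀ b, b ∈ ys ↔ b ∈ y :: xs ∧ ∀ x, μ ≠ .out x (ch b)) ∧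
        (μ' = μ ∨ ∃ x, ∃ b ∈ y :: xs, μ = .out x (ch b) ∧ μ' = .bout x b) := by
      intro h1 h2
      refine ⟨y :: ys, μ', .res hstep h1, List.nodup_cons.2 ⟨hyy, hys⟩, fun b => ?_,
        h'.imp id fun ⟨x, b, hb, h⟩ => ⟨x, b, List.mem_cons_of_mem _ hb, h⟩⟩
      simp only [List.mem_cons, hmem]
      constructor
      · rintro (rfl | h)
        · exact ⟨.inl rfl, h2⟩
        · exact ⟨.inr h.1, h.2⟩
      · rintro ⟨rfl | h, h3⟩
        · exact .inl rfl
        · exact .inr ⟨h, h3⟩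
    rcases h' with rfl | ⟨x, b, hb, rfl, rfl⟩
    · by_cases hn : ch y ∈ μ'.names
      · obtain ⟨x, rfl, hx⟩ := h.1 hn
        refine ⟨ys, .bout x y, .opn hstep hx, hys, fun b => ?_,
          .inr ⟨x, y, List.mem_cons_self, rfl, rfl⟩⟩
        simp only [List.mem_cons, hmem]
        constructor
        · exact fun h => ⟨.inr h.1, h.2⟩
        · rintro ⟨rfl | h, h3⟩
          · exact absurd rfl (h3 x)
          · exact ⟨h, h3⟩
      · exact close hn fun x e => hn (by simp [e, Action.names])
    -- An inner binder `b` has already been opened. The outer `y` differs from `b` because binders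
    -- are distinct, and from `x` by the hypothesis on `y`.
    · have hyb : y ≠ b := by rintro rfl; exact hy hb
      have hyx : ch y ≠ x := by
        rintro rfl
        obtain ⟨_, e, -⟩ := h.1 (by simp [Action.names])
        simp only [Action.out.injEq, ch.injEq] at e
        exact hyb e.2.symm
      exact close (by simp [Action.names, hyx, hyb]) (by simp [hyb.symm])

theorem exists_step_move (S : Network k) {i : Fin k} {μ : Action} {Q : Proc}
    (hA : Act (S.comp i) μ Q) (hb : ∀ l, l ≠ i → Disjoint μ.bn (S.comp l).fn)
    (hn : ∀ z ∈ S.boundNames, z ∈ μ.names → ∃ x, μ = .out x z ∧ x ≠ z) :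
    ∃ (S' : Network k) (μ' : Action) (R : Fin k → Proc),
      S.Step (Function.update (fun _ => none) i (some μ)) μ' R S' ∧
      S'.comp = Function.update S.comp i Q ∧
      (∀ z, z ∈ S'.boundNames ↔ z ∈ S.boundNames ∧ ∀ x, μ ≠ .out x z) ∧
      ((∀ x b, μ ≠ .out x (ch b)) → μ' = μ) := by
  obtain ⟨ys, μ', hstep, hys, hmem, h'⟩ := exists_binderStep S.nodup (μ := μ)
    fun b hb h => hn _ ⟨b, hb, rfl⟩ h
  refine ⟨⟨ys, hys, _⟩, μ', _, ⟨_, _, _, .move i hA.trans hb, hstep, ?_⟩, rfl, ?_, ?_⟩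
  · rw [List.append_nil]
    exact .refl _
  · simp only [boundNames, Set.mem_ofPred_eq, hmem]
    intro z
    constructor
    · rintro ⟨b, hb, rfl⟩
      exact ⟨⟨b, hb.1, rfl⟩, hb.2⟩
    · rintro ⟨⟨b, hb, rfl⟩, h⟩
      exact ⟨b, ⟨hb, h⟩, rfl⟩
  · intro h
    rcases h' with h' | ⟨x, b, -, h', -⟩
    · exact h'
    · exact absurd h' (h x b)

theorem binderStep_tau (xs : List ℕ) : BinderStep xs .tau xs .tau := by
  induction xs with
  | nil => exact .nil _
  | cons y xs ih => exact .res ih (by simp [Action.names])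

theorem exists_step_com (S : Network k) {i j : Fin k} (hij : i ≠ j) {x y : Name} {o : Action}
    {Q R : Proc} (hi : Act (S.comp i) (.inp x y) Q) (hj : Act (S.comp j) o R)
    (ho : o = .out x y ∨ ∃ c, y = ch c ∧ o = .bout x c ∧ ch c ∉ S.boundNames ∧
      ∀ l, ch c ∉ (S.comp l).fn) :
    ∃ (S' : Network k) (Q' : Fin k → Proc),
      S.Step (Function.update (Function.update (fun _ => none) i (some (.inp x y))) j (some o))
        .tau Q' S' ∧
      S'.comp = Function.update (Function.update S.comp i Q) j R ∧
      ∀ z, z ∈ S'.boundNames ↔ z ∈ S.boundNames ∨ z ∈ o.bn := by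
  rcases ho with rfl | ⟨c, rfl, rfl, hc, hl⟩
  · refine ⟨⟨S.binders, S.nodup, _⟩, _, ⟨_, _, _, .com i j hij hi.trans hj.trans,
      binderStep_tau _, ?_⟩, rfl, fun z => by simp [boundNames, Action.bn]⟩
    rw [List.append_nil]
    exact .refl _
  · have hc : c ∉ S.binders := fun h => hc ⟨c, h, rfl⟩
    -- The name created by Close becomes the innermost binder. The result is literally in network
    -- form, so reflexivity suffices for the congruence.
    refine ⟨⟨S.binders ++ [c], S.nodup.append (by simp) (by simpa using hc), _⟩, _,
      ⟨_, _, _, .close i j hij hi.trans hj.trans fun l _ => hl l, binderStep_tau _, .refl _⟩,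
      rfl, fun z => ?_⟩
    simp only [boundNames, List.mem_append, List.mem_singleton, Set.mem_ofPred_eq, Action.bn,
      Finset.mem_singleton]
    constructor
    · rintro ⟨b, hb | rfl, rfl⟩
      · exact .inl ⟨b, hb, rfl⟩
      · exact .inr rfl
    · rintro (⟨b, hb, rfl⟩ | rfl)
      · exact ⟨b, .inl hb, rfl⟩
      · exact ⟨c, .inr rfl, rfl⟩

/-- No component announces a leader. -/
def Quiet (act : Fin k → Option Action) : Prop :=
  ∀ i n : Fin k, act i ≠ some (.out Name.out (Name.id n))

/-- There is a step in which no component announces a leader. -/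
def Next (S S' : Network k) : Prop :=
  ∃ act μ Q, S.Step act μ Q S' ∧ Quiet act

/-! ### Symmetric networks -/

/-- The orbit of `ch c` under `π` has `p` elements, all of which are channels outside `F`. -/
structure Fresh (π : Equiv.Perm Name) (p : ℕ) (F : Finset Name) (c : ℕ) : Prop where
  notMem : ∀ r : ℕ, ∃ n, (π ^ r) (ch c) = ch n ∧ ch n ∉ F
  modEq : ∀ r s : ℕ, (π ^ r) (ch c) = (π ^ s) (ch c) → r ≡ s [MOD p]

/-- All the orbits of `σ` have `p ≥ 2` elements, and `π` is an action of the same cyclic group on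
the names, with infinitely many free orbits of channels. -/
structure Rotation (σ : Equiv.Perm (Fin k)) (π : Equiv.Perm Name) (p : ℕ) : Prop where
  two_le : 2 ≤ p
  pow_eq_one : π ^ p = 1
  node : ∀ (i : Fin k) (r s : ℕ), (σ ^ r) i = (σ ^ s) i ↔ r ≡ s [MOD p]
  out : π out = out
  id : ∀ i : Fin k, π (Name.id i) = Name.id (σ i : Fin k)
  fresh : ∀ F : Finset Name, ∃ c, Fresh π p F c

/-- The network is invariant under `σ` and `π`. -/
structure Balanced (σ : Equiv.Perm (Fin k)) (π : Equiv.Perm Name) (S : Network k) : Prop where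
  comp : ∀ i, S.comp (σ i) = (S.comp i).rename π
  bound : ∀ z, π z ∈ S.boundNames ↔ z ∈ S.boundNames
  separate : ∀ i, (S.comp i).Separate

/-- The names that occur in a network. -/
def support (S : Network k) : Finset Name :=
  (Finset.univ.biUnion fun i => (S.comp i).fn) ∪ S.binders.toFinset.image ch

theorem mem_support_of_comp {S : Network k} {i : Fin k} {z : Name} (h : z ∈ (S.comp i).fn) :
    z ∈ S.support :=
  Finset.mem_union_left _ (Finset.mem_biUnion.2 ⟨i, Finset.mem_univ i, h⟩)

theorem mem_support_of_bound {S : Network k} {z : Name} (h : z ∈ S.boundNames) :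
    z ∈ S.support := by
  obtain ⟨n, hn, rfl⟩ := h
  exact Finset.mem_union_right _ (Finset.mem_image.2 ⟨n, by simpa using hn, rfl⟩)

/-- Over a full period the set of points reached from `a` is stable under `f`. This is why symmetry
holds again exactly when a round is complete. -/
theorem exists_pow_lt_iff {α : Type*} {f : Equiv.Perm α} {p : ℕ} (hp : 0 < p) (h : f ^ p = 1)
    {a b : α} : (∃ r < p, (f ^ r) a = f b) ↔ ∃ r < p, (f ^ r) a = b := by
  have hmod : ∀ r, f ^ r = f ^ (r % p) := fun r => by
    conv_lhs => rw [← Nat.mod_add_div r p, pow_add, pow_mul, h, one_pow, mul_one]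
  constructor
  · rintro ⟨r, -, hr⟩
    -- The power `p - 1` serves as the inverse of `f`.
    refine ⟨(p - 1 + r) % p, Nat.mod_lt _ hp, ?_⟩
    rw [← hmod, pow_add, Equiv.Perm.mul_apply, hr, ← Equiv.Perm.mul_apply, ← pow_succ,
      Nat.sub_add_cancel hp, h, Equiv.Perm.one_apply]
  · rintro ⟨r, -, rfl⟩
    exact ⟨(r + 1) % p, Nat.mod_lt _ hp, by rw [← hmod, pow_succ', Equiv.Perm.mul_apply]⟩

section

variable {σ : Equiv.Perm (Fin k)} {π : Equiv.Perm Name} {p : ℕ} {S : Network k}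

namespace Rotation

theorem node_pow (h : Rotation σ π p) : σ ^ p = 1 :=
  Equiv.ext fun i => by simpa using (h.node i p 0).2 (by simp [Nat.ModEq])

theorem pos (h : Rotation σ π p) : 0 < p := by have := h.two_le; omega

theorem pow_congr (h : Rotation σ π p) {r s : ℕ} (hrs : r ≡ s [MOD p]) : π ^ r = π ^ s := by
  have hmod : ∀ r, π ^ r = π ^ (r % p) := fun r => by
    conv_lhs => rw [← Nat.mod_add_div r p, pow_add, pow_mul, h.pow_eq_one, one_pow, mul_one]
  rw [hmod r, hmod s, hrs]

/-- Since every node orbit has exactly `p` elements, a node determines the exponent modulo `p`,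
hence the renaming. -/
theorem pow_eq (h : Rotation σ π p) {i : Fin k} {r s : ℕ} (hrs : (σ ^ r) i = (σ ^ s) i) :
    π ^ r = π ^ s :=
  h.pow_congr ((h.node i r s).1 hrs)

theorem pow_out (h : Rotation σ π p) (r : ℕ) : (π ^ r) Name.out = Name.out := by
  induction r with
  | zero => rfl
  | succ r ih => rw [pow_succ, Equiv.Perm.mul_apply, h.out, ih]

theorem pow_id (h : Rotation σ π p) (r : ℕ) (i : Fin k) :
    (π ^ r) (Name.id i) = Name.id ((σ ^ r) i : Fin k) := by
  induction r generalizing i with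
  | zero => rfl
  | succ r ih => rw [pow_succ, Equiv.Perm.mul_apply, h.id, ih, pow_succ, Equiv.Perm.mul_apply]

/-- Announcements are permuted among themselves, so a round that starts with a different action
contains none. -/
theorem eq_announce (h : Rotation σ π p) {μ : Action} {r : ℕ} {n : Fin k}
    (e : μ.map (π ^ r : Equiv.Perm Name) = .out Name.out (Name.id n)) :
    ∃ m : Fin k, μ = .out Name.out (Name.id m) := by
  cases μ <;> simp only [Action.map, Action.out.injEq, reduceCtorEq] at e
  refine ⟨(σ ^ r).symm n, ?_⟩
  congr 1
  · exact (π ^ r).injective (by rw [e.1, h.pow_out])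
  · exact (π ^ r).injective (by rw [e.2, h.pow_id, Equiv.apply_symm_apply])

end Rotation

namespace Balanced

theorem comp_pow (h : Balanced σ π S) (r : ℕ) (i : Fin k) :
    S.comp ((σ ^ r) i) = (S.comp i).rename (π ^ r : Equiv.Perm Name) := by
  induction r generalizing i with
  | zero => simp
  | succ r ih =>
    rw [pow_succ, Equiv.Perm.mul_apply, ih, h.comp, Proc.rename_rename, pow_succ]
    rfl

theorem bound_pow (h : Balanced σ π S) (r : ℕ) (z : Name) :
    (π ^ r) z ∈ S.boundNames ↔ z ∈ S.boundNames := by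
  induction r generalizing z with
  | zero => rfl
  | succ r ih => rw [pow_succ, Equiv.Perm.mul_apply, ih, h.bound]

end Balanced

/-! ### Spreading a process along an orbit. -/

open Classical in
/-- The process `R` at the node `i` and its renamings at the other nodes of the orbit. -/
noncomputable def spread (σ : Equiv.Perm (Fin k)) (π : Equiv.Perm Name) (S : Network k)
    (i : Fin k) (R : Proc) (l : Fin k) : Proc :=
  if h : ∃ r : ℕ, (σ ^ r) i = l then R.rename (π ^ h.choose : Equiv.Perm Name) else S.comp l

/-- The exponent picked by choice in `spread` is immaterial, by `Rotation.pow_eq`. -/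
theorem spread_pow (h : Rotation σ π p) (S : Network k) (i : Fin k) (R : Proc) (r : ℕ) :
    spread σ π S i R ((σ ^ r) i) = R.rename (π ^ r : Equiv.Perm Name) := by
  have hr : ∃ s : ℕ, (σ ^ s) i = (σ ^ r) i := ⟨r, rfl⟩
  rw [spread, dif_pos hr, h.pow_eq hr.choose_spec]

theorem spread_self (h : Rotation σ π p) (hS : Balanced σ π S) (i l : Fin k) :
    spread σ π S i (S.comp i) l = S.comp l := by
  by_cases hl : ∃ r : ℕ, (σ ^ r) i = l
  · obtain ⟨r, rfl⟩ := hl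
    rw [spread_pow h, hS.comp_pow]
  · rw [spread, dif_neg hl]

theorem mem_orbit_iff (h : Rotation σ π p) {i l : Fin k} :
    (∃ r : ℕ, (σ ^ r) i = σ l) ↔ ∃ r : ℕ, (σ ^ r) i = l := by
  constructor
  · rintro ⟨r, hr⟩
    refine ⟨p - 1 + r, ?_⟩
    rw [pow_add, Equiv.Perm.mul_apply, hr, ← Equiv.Perm.mul_apply, ← pow_succ,
      Nat.sub_add_cancel h.pos, h.node_pow, Equiv.Perm.one_apply]
  · rintro ⟨r, rfl⟩
    exact ⟨r + 1, by rw [pow_succ', Equiv.Perm.mul_apply]⟩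

theorem spread_node (h : Rotation σ π p) (hS : Balanced σ π S) (i : Fin k) (R : Proc)
    (l : Fin k) : spread σ π S i R (σ l) = (spread σ π S i R l).rename π := by
  by_cases hl : ∃ r : ℕ, (σ ^ r) i = l
  · obtain ⟨r, rfl⟩ := hl
    rw [← Equiv.Perm.mul_apply, ← pow_succ', spread_pow h, spread_pow h, Proc.rename_rename,
      pow_succ']
    rfl
  · rw [spread, spread, dif_neg hl, dif_neg (by rwa [mem_orbit_iff h]), hS.comp]

/-! ### Rounds: repeating one transition along an orbit. -/

theorem Fresh.bn_map {F : Finset Name} {c : ℕ} (h : Fresh π p F c) (x : Name) (r : ℕ) :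
    ∃ n, (π ^ r) (ch c) = ch n ∧ (Action.bout x c).map (π ^ r : Equiv.Perm Name) =
      .bout ((π ^ r) x) n := by
  obtain ⟨n, hn, -⟩ := h.notMem r
  exact ⟨n, hn, by simp [Action.map, hn]⟩

theorem Rotation.eq_of_pow_eq (h : Rotation σ π p) {i : Fin k} {r s : ℕ} (hr : r < p) (hs : s < p)
    (e : (σ ^ r) i = (σ ^ s) i) : r = s :=
  ((h.node i r s).1 e).eq_of_lt_of_lt hr hs

/-- If a component can move alone, then all the components of its orbit can move in turn, and
restore the symmetry. -/
theorem Balanced.round_move (h : Rotation σ π p) (hS : Balanced σ π S) {i : Fin k} {μ : Action}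
    {Q : Proc} (hA : Act (S.comp i) μ Q)
    (hn : ∀ z ∈ S.boundNames, z ∈ μ.names → ∃ x, μ = .out x z ∧ x ≠ z)
    (hf : ∀ x c, μ = .bout x c → Fresh π p S.support c)
    (hq : ∀ n : Fin k, μ ≠ .out Name.out (Name.id n)) :
    ∃ S', Relation.TransGen Next S S' ∧ Balanced σ π S' := by
  classical
  -- The state after `t` moves: the first `t` nodes of the orbit have acted, the binders extruded by
  -- them are gone, and every new free name is an object of one of their actions.
  have key : ∀ t ≤ p, ∃ S' : Network k, (t = 0 → S' = S) ∧
      (0 < t → Relation.TransGen Next S S') ∧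
      (∀ l, S'.comp l = if ∃ r < t, (σ ^ r) i = l then spread σ π S i Q l else S.comp l) ∧
      (∀ z, z ∈ S'.boundNames ↔ z ∈ S.boundNames ∧
        ¬ ∃ r < t, ∃ x y, μ = .out x y ∧ (π ^ r) y = z) ∧
      (∀ l, (S'.comp l).Separate) ∧
      (∀ l, ∀ z ∈ (S'.comp l).fn, z ∈ S.support ∨
        ∃ r < t, z ∈ (μ.map (π ^ r : Equiv.Perm Name)).objects) := by
    intro t
    induction t with
    | zero =>
      exact fun _ => ⟨S, by simp, by simp, by simp, by simp, hS.separate,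
        fun l z hz => .inl (mem_support_of_comp hz)⟩
    | succ t ih =>
      intro ht
      obtain ⟨T, hT0, hT1, hcomp, hbound, hsep, hfn⟩ := ih (by omega)
      -- As `t < p`, the node now served is not among those already served.
      have hi : T.comp ((σ ^ t) i) = (S.comp i).rename (π ^ t : Equiv.Perm Name) := by
        rw [hcomp, if_neg, hS.comp_pow]
        rintro ⟨r, hr, e⟩
        exact hr.ne (h.eq_of_pow_eq (by omega) (by omega) e)
      have hA' : Act (T.comp ((σ ^ t) i)) (μ.map (π ^ t : Equiv.Perm Name))
          (Q.rename (π ^ t : Equiv.Perm Name)) := by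
        rw [hi]
        refine hA.rename (π ^ t).injective fun z hz => ?_
        cases μ <;> simp only [Action.bn, Finset.notMem_empty, Finset.mem_singleton] at hz
        obtain ⟨n, hn, -⟩ := (hf _ _ rfl).notMem t
        exact ⟨n, hz ▸ hn⟩
      have hdisj : ∀ l, l ≠ (σ ^ t) i →
          Disjoint (μ.map (π ^ t : Equiv.Perm Name)).bn (T.comp l).fn := by
        intro l _
        cases μ with
        | bout x c =>
          have hc := hf x c rfl
          obtain ⟨n, hn, hn'⟩ := hc.notMem t
          obtain ⟨_, e, hmap⟩ := hc.bn_map x t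
          obtain rfl : n = _ := by simpa [hn] using e
          rw [hmap]
          simp only [Action.bn, Finset.disjoint_singleton_left]
          intro hmem
          rcases hfn l _ hmem with hmem | ⟨r, hr, hmem⟩
          · exact hn' hmem
          · obtain ⟨m, hm, e⟩ := hc.bn_map x r
            rw [e] at hmem
            simp only [Action.objects, Finset.mem_singleton] at hmem
            -- The names extruded at different times of the round are distinct, because the orbit of
            -- `ch c` is free.
            exact hr.ne ((hc.modEq r t (by rw [hm, hn, hmem])).eq_of_lt_of_lt (by omega) (by omega))
        | _ => simp [Action.map, Action.bn]
      have hnames : ∀ z ∈ T.boundNames, z ∈ (μ.map (π ^ t : Equiv.Perm Name)).names →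
          ∃ x, μ.map (π ^ t : Equiv.Perm Name) = .out x z ∧ x ≠ z := by
        intro z hz hz'
        rw [hbound] at hz
        cases μ with
        | inp x y =>
          simp only [Action.map, Action.names, Finset.mem_insert, Finset.mem_singleton] at hz'
          rcases hz' with rfl | rfl
          · obtain ⟨_, e, -⟩ := hn x ((hS.bound_pow t x).1 hz.1) (by simp [Action.names])
            cases e
          · obtain ⟨_, e, -⟩ := hn y ((hS.bound_pow t y).1 hz.1) (by simp [Action.names])
            cases e
        | out x y =>
          simp only [Action.map, Action.names, Finset.mem_insert, Finset.mem_singleton] at hz'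
          have hx : (π ^ t) x ∉ S.boundNames := by
            rw [hS.bound_pow]
            intro hx
            obtain ⟨_, e, hne⟩ := hn x hx (by simp [Action.names])
            simp only [Action.out.injEq] at e
            exact hne e.1.symm
          rcases hz' with rfl | rfl
          · exact absurd hz.1 hx
          · exact ⟨_, rfl, fun e => hx (e ▸ hz.1)⟩
        | bout x c =>
          obtain ⟨n, hn', hn''⟩ := (hf x c rfl).notMem t
          obtain ⟨_, e, hmap⟩ := (hf x c rfl).bn_map x t
          obtain rfl : n = _ := by simpa [hn'] using e
          rw [hmap] at hz'
          simp only [Action.names, Finset.mem_insert, Finset.mem_singleton] at hz'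
          rcases hz' with rfl | rfl
          · obtain ⟨_, e, -⟩ := hn x ((hS.bound_pow t x).1 hz.1) (by simp [Action.names])
            cases e
          · exact absurd (mem_support_of_bound hz.1) hn''
        | tau => simp [Action.map, Action.names] at hz'
      obtain ⟨T', μ', R, hstep, hcomp', hbound', -⟩ := T.exists_step_move hA' hdisj hnames
      have hnext : Next T T' := by
        refine ⟨_, _, _, hstep, fun l n e => ?_⟩
        by_cases hl : l = (σ ^ t) i
        · subst hl
          rw [Function.update_self, Option.some.injEq] at e
          obtain ⟨m, hm⟩ := h.eq_announce e
          exact hq m hm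
        · rw [Function.update_of_ne hl] at e
          cases e
      refine ⟨T', by simp, fun _ => ?_, fun l => ?_, fun z => ?_, fun l => ?_, fun l z hz => ?_⟩
      · rcases Nat.eq_zero_or_pos t with rfl | ht
        · rw [hT0 rfl] at hnext
          exact .single hnext
        · exact (hT1 ht).tail hnext
      · rw [hcomp']
        by_cases hl : l = (σ ^ t) i
        · subst hl
          rw [Function.update_self, if_pos ⟨t, by omega, rfl⟩, spread_pow h]
        · rw [Function.update_of_ne hl, hcomp]
          congr 1
          refine propext ⟨fun ⟨r, hr, e⟩ => ⟨r, by omega, e⟩, fun ⟨r, hr, e⟩ => ⟨r, ?_, e⟩⟩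
          rcases Nat.lt_succ_iff_lt_or_eq.1 hr with hr | rfl
          · exact hr
          · exact absurd e.symm hl
      · rw [hbound', hbound, and_assoc]
        refine and_congr_right fun _ => ?_
        constructor
        · rintro ⟨h1, h2⟩ ⟨r, hr, x, y, rfl, e⟩
          rcases Nat.lt_succ_iff_lt_or_eq.1 hr with hr | rfl
          · exact h1 ⟨r, hr, x, y, rfl, e⟩
          · exact h2 ((π ^ r) x) (by rw [← e]; rfl)
        · intro h1
          refine ⟨fun ⟨r, hr, e⟩ => h1 ⟨r, by omega, e⟩, fun x e => h1 ⟨t, by omega, ?_⟩⟩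
          cases μ <;> simp only [Action.map, Action.out.injEq, reduceCtorEq] at e
          exact ⟨_, _, rfl, e.2⟩
      · rw [hcomp']
        by_cases hl : l = (σ ^ t) i
        · subst hl
          rw [Function.update_self]
          exact hA'.separate (hsep _)
        · rw [Function.update_of_ne hl]
          exact hsep l
      · have hz' : z ∈ (T.comp l).fn ∨ z ∈ (μ.map (π ^ t : Equiv.Perm Name)).objects := by
          rw [hcomp'] at hz
          by_cases hl : l = (σ ^ t) i
          · subst hl
            rw [Function.update_self] at hz
            exact Finset.mem_union.1 (hA'.fn_subset hz)
          · rw [Function.update_of_ne hl] at hz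
            exact .inl hz
        rcases hz' with hz' | hz'
        · exact (hfn l z hz').imp_right fun ⟨r, hr, e⟩ => ⟨r, by omega, e⟩
        · exact .inr ⟨t, by omega, hz'⟩
  obtain ⟨S', -, h1, hcomp, hbound, hsep, -⟩ := key p le_rfl
  -- After `p` moves, the set of nodes served and the set of binders removed are both full orbits.
  refine ⟨S', h1 h.pos, fun l => ?_, fun z => ?_, hsep⟩
  · simp only [hcomp, exists_pow_lt_iff h.pos h.node_pow]
    split_ifs
    · exact spread_node h hS i Q l
    · exact hS.comp l
  · rw [hbound, hbound, hS.bound]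
    refine and_congr_right fun _ => not_congr ?_
    cases μ with
    | out x y =>
      simpa using exists_pow_lt_iff h.pos h.pow_eq_one (a := y) (b := z)
    | _ => simp

/-- If two components can communicate, then all the pairs of their orbit can do it in turn, and
restore the symmetry. The process `X l a b` is the component `l` after its output (if `a`) and its
input (if `b`). -/
theorem Balanced.round_com (h : Rotation σ π p) (hS : Balanced σ π S) {i j : Fin k} (hij : i ≠ j)
    (X : Fin k → Prop → Prop → Proc) (hX : ∀ l, X l False False = S.comp l)
    (hXσ : ∀ l a b, X (σ l) a b = (X l a b).rename π) {x y : Name} {o : Action}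
    (hin : ∀ a, Act (X j a False) (.inp x y) (X j a True))
    (hout : ∀ b, Act (X i False b) o (X i True b))
    (ho : o = .out x y ∨ ∃ c, y = ch c ∧ o = .bout x c ∧ Fresh π p S.support c)
    (hq : ∀ n : Fin k, o ≠ .out Name.out (Name.id n)) :
    ∃ S', Relation.TransGen Next S S' ∧ Balanced σ π S' := by
  have hXpow : ∀ (r : ℕ) l a b,
      X ((σ ^ r) l) a b = (X l a b).rename (π ^ r : Equiv.Perm Name) := by
    intro r
    induction r with
    | zero => simp
    | succ r ih =>
      intro l a b
      rw [pow_succ, Equiv.Perm.mul_apply, ih, hXσ, Proc.rename_rename, pow_succ]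
      rfl
  -- At time `t` the node `(σ ^ t) i` sends to `(σ ^ t) j`. A node of both orbits is served twice,
  -- in an order that depends on the node; the two propositional arguments of `X` record what it has
  -- done so far.
  have key : ∀ t ≤ p, ∃ S' : Network k, (t = 0 → S' = S) ∧
      (0 < t → Relation.TransGen Next S S') ∧
      (∀ l, S'.comp l = X l (∃ r < t, (σ ^ r) i = l) (∃ r < t, (σ ^ r) j = l)) ∧
      (∀ z, z ∈ S'.boundNames ↔ z ∈ S.boundNames ∨
        o.bn.Nonempty ∧ ∃ r < t, (π ^ r) y = z) ∧
      (∀ l, (S'.comp l).Separate) ∧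
      (∀ l, ∀ z ∈ (S'.comp l).fn, z ∈ S.support ∨ ∃ r < t, (π ^ r) y = z) := by
    intro t
    induction t with
    | zero =>
      exact fun _ => ⟨S, by simp, by simp, by simp [hX], by simp, hS.separate,
        fun l z hz => .inl (mem_support_of_comp hz)⟩
    | succ t ih =>
      intro ht
      obtain ⟨T, hT0, hT1, hcomp, hbound, hsep, hfn⟩ := ih (by omega)
      have hfalse : ∀ l, (∃ r < t, (σ ^ r) l = (σ ^ t) l) = False := by
        refine fun l => eq_false ?_
        rintro ⟨r, hr, e⟩
        exact hr.ne (h.eq_of_pow_eq (by omega) (by omega) e)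
      have htrue : ∀ l, (∃ r < t + 1, (σ ^ r) l = (σ ^ t) l) = True :=
        fun l => eq_true ⟨t, by omega, rfl⟩
      have hsame : ∀ l m, m ≠ (σ ^ t) l →
          (∃ r < t + 1, (σ ^ r) l = m) = ∃ r < t, (σ ^ r) l = m := by
        refine fun l m hm => propext ⟨fun ⟨r, hr, e⟩ => ⟨r, ?_, e⟩,
          fun ⟨r, hr, e⟩ => ⟨r, by omega, e⟩⟩
        rcases Nat.lt_succ_iff_lt_or_eq.1 hr with hr | rfl
        · exact hr
        · exact absurd e.symm hm
      have hne : (σ ^ t) i ≠ (σ ^ t) j := fun e => hij ((σ ^ t).injective e)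
      have hi : Act (T.comp ((σ ^ t) i)) (o.map (π ^ t : Equiv.Perm Name))
          (X ((σ ^ t) i) True (∃ r < t, (σ ^ r) j = (σ ^ t) i)) := by
        rw [hcomp, hfalse, hXpow, hXpow]
        refine (hout _).rename (π ^ t).injective fun z hz => ?_
        rcases ho with rfl | ⟨c, rfl, rfl, hc⟩
        · simp [Action.bn] at hz
        · simp only [Action.bn, Finset.mem_singleton] at hz
          obtain ⟨n, hn, -⟩ := hc.notMem t
          exact ⟨n, hz ▸ hn⟩
      have hj : Act (T.comp ((σ ^ t) j)) (.inp ((π ^ t) x) ((π ^ t) y))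
          (X ((σ ^ t) j) (∃ r < t, (σ ^ r) i = (σ ^ t) j) True) := by
        rw [hcomp, hfalse, hXpow, hXpow]
        exact (hin _).rename (π ^ t).injective (by simp [Action.bn])
      obtain ⟨T', R, hstep, hcomp', hbound'⟩ := T.exists_step_com hne.symm hj hi (by
        rcases ho with rfl | ⟨c, rfl, rfl, hc⟩
        · exact .inl rfl
        · obtain ⟨n, hn, hn'⟩ := hc.notMem t
          obtain ⟨_, e, hmap⟩ := hc.bn_map x t
          obtain rfl : n = _ := by simpa [hn] using e
          have hnot : ¬ ∃ r < t, (π ^ r) (ch c) = ch n := by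
            rintro ⟨r, hr, e⟩
            exact hr.ne ((hc.modEq r t (e.trans hn.symm)).eq_of_lt_of_lt (by omega) (by omega))
          refine .inr ⟨n, hn, hmap, ?_, fun l hl => ?_⟩
          · rw [hbound]
            rintro (hb | hb)
            · exact hn' (mem_support_of_bound hb)
            · exact hnot hb.2
          · exact (hfn l _ hl).elim hn' hnot)
      have hnext : Next T T' := by
        refine ⟨_, _, _, hstep, fun l n e => ?_⟩
        by_cases hl : l = (σ ^ t) i
        · subst hl
          rw [Function.update_self, Option.some.injEq] at e
          obtain ⟨m, hm⟩ := h.eq_announce e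
          exact hq m hm
        · rw [Function.update_of_ne hl] at e
          by_cases hl' : l = (σ ^ t) j
          · subst hl'
            rw [Function.update_self] at e
            cases e
          · rw [Function.update_of_ne hl'] at e
            cases e
      have hbn : ∀ z, z ∈ (o.map (π ^ t : Equiv.Perm Name)).bn ↔
          o.bn.Nonempty ∧ (π ^ t) y = z := by
        intro z
        rcases ho with rfl | ⟨c, rfl, rfl, hc⟩
        · simp [Action.map, Action.bn]
        · obtain ⟨n, hn, hmap⟩ := hc.bn_map x t
          rw [hmap, hn]
          simp [Action.bn, eq_comm]
      refine ⟨T', by simp, fun _ => ?_, fun l => ?_, fun z => ?_, fun l => ?_, fun l z hz => ?_⟩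
      · rcases Nat.eq_zero_or_pos t with rfl | ht
        · rw [hT0 rfl] at hnext
          exact .single hnext
        · exact (hT1 ht).tail hnext
      · rw [hcomp']
        by_cases hl : l = (σ ^ t) i
        · subst hl
          rw [Function.update_self, htrue, hsame j _ hne]
        · rw [Function.update_of_ne hl]
          by_cases hl' : l = (σ ^ t) j
          · subst hl'
            rw [Function.update_self, htrue, hsame i _ hl]
          · rw [Function.update_of_ne hl', hcomp, hsame i _ hl, hsame j _ hl']
      · rw [hbound', hbound, hbn, or_assoc, ← and_or_left]
        refine or_congr_right (and_congr_right fun _ => ?_)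
        constructor
        · rintro (⟨r, hr, e⟩ | e)
          · exact ⟨r, by omega, e⟩
          · exact ⟨t, by omega, e⟩
        · rintro ⟨r, hr, e⟩
          rcases Nat.lt_succ_iff_lt_or_eq.1 hr with hr | rfl
          · exact .inl ⟨r, hr, e⟩
          · exact .inr e
      · rw [hcomp']
        by_cases hl : l = (σ ^ t) i
        · subst hl
          rw [Function.update_self]
          exact hi.separate (hsep _)
        · rw [Function.update_of_ne hl]
          by_cases hl' : l = (σ ^ t) j
          · subst hl'
            rw [Function.update_self]
            exact hj.separate (hsep _)
          · rw [Function.update_of_ne hl']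
            exact hsep l
      · have hz' : z ∈ (T.comp l).fn ∨ (π ^ t) y = z := by
          rw [hcomp'] at hz
          by_cases hl : l = (σ ^ t) i
          · subst hl
            rw [Function.update_self] at hz
            refine (Finset.mem_union.1 (hi.fn_subset hz)).imp_right fun hz => ?_
            refine ((hbn z).1 ?_).2
            rcases ho with rfl | ⟨c, rfl, rfl, hc⟩ <;> exact hz
          · rw [Function.update_of_ne hl] at hz
            by_cases hl' : l = (σ ^ t) j
            · subst hl'
              rw [Function.update_self] at hz
              refine (Finset.mem_union.1 (hj.fn_subset hz)).imp_right fun hz => ?_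
              exact (Finset.mem_singleton.1 hz).symm
            · rw [Function.update_of_ne hl'] at hz
              exact .inl hz
        rcases hz' with hz' | hz'
        · exact (hfn l z hz').imp_right fun ⟨r, hr, e⟩ => ⟨r, by omega, e⟩
        · exact .inr ⟨t, by omega, hz'⟩
  obtain ⟨S', -, h1, hcomp, hbound, hsep, -⟩ := key p le_rfl
  refine ⟨S', h1 h.pos, fun l => ?_, fun z => ?_, hsep⟩
  · rw [hcomp, hcomp, exists_pow_lt_iff h.pos h.node_pow, exists_pow_lt_iff h.pos h.node_pow]
    exact hXσ _ _ _
  · rw [hbound, hbound, hS.bound, exists_pow_lt_iff h.pos h.pow_eq_one]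

end

end Network

namespace Network

variable {k : ℕ}

/-! ### Progress without announcements -/

section

variable {σ : Equiv.Perm (Fin k)} {π : Equiv.Perm Name} {p : ℕ} {S : Network k}

theorem out_notMem_boundNames : Name.out ∉ S.boundNames := by
  rintro ⟨n, -, h⟩
  cases h

theorem id_notMem_boundNames (n : ℕ) : Name.id n ∉ S.boundNames := by
  rintro ⟨n, -, h⟩
  cases h

theorem Fresh.notMem_support {c : ℕ} (hc : Fresh π p S.support c) : ch c ∉ S.support := by
  obtain ⟨n, hn, hn'⟩ := hc.notMem 0
  rwa [show ch c = ch n from hn]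

/-- Only the label need be enabled: the objects of inputs and of bound outputs can be chosen anew to
suit the round. -/
theorem Balanced.exists_round_of_move (h : Rotation σ π p) (hS : Balanced σ π S) {i : Fin k}
    {μ : Action} (hc : (S.comp i).Can μ.label) (hsub : ∀ z ∈ S.boundNames, z ∉ μ.subject)
    (hq : ∀ n : Fin k, ¬ (S.comp i).Can (.out Name.out (Name.id n))) :
    ∃ S', Relation.TransGen Next S S' ∧ Balanced σ π S' := by
  cases μ with
  | inp x y =>
    -- The received name is immaterial; `out` is never bound, so the action passes the restrictions.
    obtain ⟨Q, hA⟩ := Proc.Can.exists_act (μ := .inp x Name.out) hc (by simp [Action.bn])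
    refine hS.round_move h hA (fun z hz hz' => ?_) (by simp) (by simp)
    simp only [Action.names, Finset.mem_insert, Finset.mem_singleton] at hz'
    rcases hz' with rfl | rfl
    · exact absurd (by simp [Action.subject]) (hsub _ hz)
    · exact absurd hz out_notMem_boundNames
  | out x y =>
    obtain ⟨Q, hA⟩ := Proc.Can.exists_act (μ := .out x y) hc (by simp [Action.bn])
    refine hS.round_move h hA (fun z hz hz' => ?_) (by simp) ?_
    · have hx : x ≠ z := by
        rintro rfl
        exact absurd (by simp [Action.subject]) (hsub _ hz)
      simp only [Action.names, Finset.mem_insert, Finset.mem_singleton] at hz'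
      rcases hz' with rfl | rfl
      · exact absurd rfl hx
      · exact ⟨x, rfl, hx⟩
    · intro n e
      simp only [Action.out.injEq] at e
      exact hq n (by rw [← e.1, ← e.2]; exact hc)
  | bout x y =>
    obtain ⟨c, hfresh⟩ := h.fresh S.support
    obtain ⟨Q, hA⟩ := Proc.Can.exists_act (μ := .bout x c) hc (by
      simpa [Action.bn] using fun h => hfresh.notMem_support (mem_support_of_comp h))
    refine hS.round_move h hA (fun z hz hz' => ?_) ?_ (by simp)
    · simp only [Action.names, Finset.mem_insert, Finset.mem_singleton] at hz'
      rcases hz' with rfl | rfl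
      · exact absurd (by simp [Action.subject]) (hsub _ hz)
      · exact absurd (mem_support_of_bound hz) hfresh.notMem_support
    · rintro _ _ ⟨⟩
      exact hfresh
  | tau =>
    obtain ⟨Q, hA⟩ := Proc.Can.exists_act (μ := .tau) hc (by simp [Action.bn])
    exact hS.round_move h hA (by simp [Action.names]) (by simp) (by simp)

/-- If the sender and the receiver lie in one orbit, the diamond makes the order of a node's two
actions irrelevant. If they lie in different orbits, each node acts only once. -/
theorem Balanced.exists_round_of_com (h : Rotation σ π p) (hS : Balanced σ π S) {i j : Fin k}
    (hij : i ≠ j) {x : Name} (hi : Label.Sends (S.comp i).Can x) (hj : (S.comp j).Can (.inp x))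
    (hq : ∀ n : Fin k, ¬ (S.comp i).Can (.out Name.out (Name.id n))) :
    ∃ S', Relation.TransGen Next S S' ∧ Balanced σ π S' := by
  classical
  obtain ⟨o, y, A, hA, ho, hsend, hq⟩ : ∃ o y A, Act (S.comp i) o A ∧
      (o = .out x y ∨ ∃ c, y = ch c ∧ o = .bout x c ∧ Fresh π p S.support c) ∧ o.IsSend ∧
      ∀ n : Fin k, o ≠ .out Name.out (Name.id n) := by
    rcases hi with ⟨y, hi⟩ | hi
    · obtain ⟨A, hA⟩ := Proc.Can.exists_act (μ := .out x y) hi (by simp [Action.bn])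
      refine ⟨_, y, A, hA, .inl rfl, trivial, fun n e => ?_⟩
      simp only [Action.out.injEq] at e
      exact hq n (by rw [← e.1, ← e.2]; exact hi)
    · obtain ⟨c, hc⟩ := h.fresh S.support
      obtain ⟨A, hA⟩ := Proc.Can.exists_act (μ := .bout x c) hi (by
        simpa [Action.bn] using fun h => hc.notMem_support (mem_support_of_comp h))
      exact ⟨_, ch c, A, hA, .inr ⟨c, rfl, rfl, hc⟩, trivial, by simp⟩
  by_cases horb : ∃ s : ℕ, (σ ^ s) i = j
  · obtain ⟨s, rfl⟩ := horb
    -- The receiver is a renamed copy of the sender, so its input can be pulled back to node `i`,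
    -- where the sender's own output is enabled as well.
    obtain ⟨B, hB⟩ : ∃ B, Act (S.comp i) (.inp ((π ^ s).symm x) ((π ^ s).symm y)) B := by
      refine Proc.Can.exists_act ?_ (by simp [Action.bn])
      have := hj.rename (π ^ s).symm
      rw [hS.comp_pow, Proc.rename_rename, show ⇑(π ^ s).symm ∘ ⇑(π ^ s) = _root_.id from
        (π ^ s).symm_comp_self, Proc.rename_id] at this
      exact this
    obtain ⟨D, hD1, hD2⟩ := hA.diamond (hS.separate i) hsend hB (by
      rcases ho with rfl | ⟨c, rfl, rfl, hc⟩
      · simp [Action.bn]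
      · simp only [Action.bn, Finset.mem_singleton, Equiv.symm_apply_eq]
        intro e
        -- If the pulled-back object were the extruded name itself, then `s` would be a multiple of
        -- `p` and the two nodes would coincide.
        exact hij ((h.node i 0 s).2 (hc.modEq 0 s e)))
    let X₀ : Prop → Prop → Proc := fun a b =>
      if a then (if b then D else A) else (if b then B else S.comp i)
    have hX₀ : ∀ a b, spread σ π S i (X₀ a b) i = X₀ a b := fun a b => by
      simpa using spread_pow h S i (X₀ a b) 0
    refine hS.round_com h hij (fun l a b => spread σ π S i (X₀ a b) l) (fun l => ?_)
      (fun l a b => spread_node h hS i _ l) (fun a => ?_) (fun b => ?_) ho hq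
    · simpa [X₀] using spread_self h hS i l
    · simp only [spread_pow h]
      have key : Act (X₀ a False) (.inp ((π ^ s).symm x) ((π ^ s).symm y)) (X₀ a True) := by
        by_cases ha : a
        · simpa [X₀, ha] using hD1
        · simpa [X₀, ha] using hB
      simpa [Action.map] using key.rename (π ^ s).injective (by simp [Action.bn])
    · simp only [hX₀]
      by_cases hb : b
      · simpa [X₀, hb] using hD2
      · simpa [X₀, hb] using hA
  · obtain ⟨B, hB⟩ := Proc.Can.exists_act (μ := .inp x y) hj (by simp [Action.bn])
    let X : Fin k → Prop → Prop → Proc := fun l a b =>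
      if ∃ s : ℕ, (σ ^ s) i = l then spread σ π S i (if a then A else S.comp i) l
      else spread σ π S j (if b then B else S.comp j) l
    have hXi : ∀ a b, X i a b = if a then A else S.comp i := fun a b => by
      have := spread_pow h S i (if a then A else S.comp i) 0
      simp only [X]
      rw [if_pos ⟨0, rfl⟩]
      simpa using this
    have hXj : ∀ a b, X j a b = if b then B else S.comp j := fun a b => by
      have := spread_pow h S j (if b then B else S.comp j) 0
      simp only [X]
      rw [if_neg horb]
      simpa using this
    refine hS.round_com h hij X (fun l => ?_) (fun l a b => ?_) (fun a => ?_) (fun b => ?_) ho hq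
    · simp [X, spread_self h hS]
    · simp only [X, mem_orbit_iff h]
      split_ifs <;> exact spread_node h hS _ _ _
    · simpa [hXj] using hB
    · simpa [hXi] using hA

theorem Balanced.exists_round (h : Rotation σ π p) (hS : Balanced σ π S)
    (hq : ∀ i n : Fin k, ¬ (S.comp i).Can (.out Name.out (Name.id n)))
    {act : Fin k → Option Action} {μ : Action} {Q : Fin k → Proc} {S₁ : Network k}
    (hstep : S.Step act μ Q S₁) : ∃ S', Relation.TransGen Next S S' ∧ Balanced σ π S' := by
  obtain ⟨μ₀, new, ys, hbody, hbind, -⟩ := hstep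
  cases hbody with
  | move i ht =>
    refine hS.exists_round_of_move h ht.can ?_ (hq i)
    rintro _ ⟨b, hb, rfl⟩
    exact hbind.subject.2 b hb
  | com i j hij hi hj =>
    exact hS.exists_round_of_com h hij.symm (.inl ⟨_, hj.can⟩) hi.can (hq j)
  | close i j hij hi hj =>
    exact hS.exists_round_of_com h hij.symm (.inr hj.can) hi.can (hq j)

end

/-! ### Computations -/

namespace Computation

variable {P : Network k}

theorem Extends.refl (C : Computation P) : C.Extends C :=
  ⟨le_rfl, fun _ _ => rfl, fun _ _ => rfl, fun _ _ => rfl, fun _ _ => rfl⟩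

theorem exists_snoc (C : Computation P) {m : ℕ} (hm : C.length = m) {act : Fin k → Option Action}
    {μ : Action} {Q : Fin k → Proc} {S' : Network k} (h : (C.state m).Step act μ Q S') :
    ∃ C' : Computation P, C'.length = (m + 1 : ℕ) ∧ C'.state (m + 1) = S' ∧
      (∀ n < m, C'.label n = C.label n ∧ C'.act n = C.act n) ∧ C'.label m = μ ∧
        C'.act m = act := by
  refine ⟨⟨(m + 1 : ℕ), fun n => if n ≤ m then C.state n else S',
    fun n => if n < m then C.label n else μ, fun n => if n < m then C.act n else act,
    fun n => if n < m then C.result n else Q, by simp [C.state_zero], fun n hn => ?_⟩,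
    rfl, by simp, fun n hn => by simp [hn], by simp, by simp⟩
  have hn : n < m + 1 := by exact_mod_cast hn
  rcases Nat.lt_succ_iff_lt_or_eq.1 hn with hn | rfl
  · simpa [hn, hn.le, Nat.succ_le_iff.2 hn] using C.step n (by rw [hm]; exact_mod_cast hn)
  · simpa using h

theorem exists_of_reach {S : Network k} (h : Relation.ReflTransGen Next P S) :
    ∃ (C : Computation P) (m : ℕ), C.length = m ∧ C.state m = S ∧
      ∀ n < m, Quiet (C.act n) := by
  induction h with
  | refl =>
    exact ⟨⟨0, fun _ => P, fun _ => .tau, fun _ _ => none, fun _ => P.comp, rfl,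
      fun m hm => absurd hm (by simp)⟩, 0, rfl, rfl, by simp⟩
  | tail _ hnext ih =>
    obtain ⟨C, m, hm, rfl, hquiet⟩ := ih
    obtain ⟨act, μ, Q, hstep, hact⟩ := hnext
    obtain ⟨C', h1, h2, h3, -, h5⟩ := C.exists_snoc hm hstep
    refine ⟨C', m + 1, h1, h2, fun n hn => ?_⟩
    rcases Nat.lt_succ_iff_lt_or_eq.1 hn with hn | rfl
    · rw [(h3 n hn).2]
      exact hquiet n hn
    · rwa [h5]

end Computation

section

variable {σ : Equiv.Perm (Fin k)} {π : Equiv.Perm Name} {p : ℕ} {P S : Network k}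

/-- If a component can announce a leader, then another one can announce another leader. -/
theorem Balanced.not_can_announce (h : Rotation σ π p) (hP : P.IsElectoral)
    (hS : Balanced σ π S) (hr : Relation.ReflTransGen Next P S) (i n : Fin k) :
    ¬ (S.comp i).Can (.out Name.out (Name.id n)) := by
  intro hc
  -- As `p ≥ 2`, no node is fixed. This provides both a second announcer that has not moved and a
  -- second leader.
  have hσ : ∀ l : Fin k, σ l ≠ l := fun l e => by
    have := (h.node l 1 0).1 (by simpa using e)
    have h2 := h.two_le
    rw [Nat.ModEq, Nat.mod_eq_of_lt (by omega), Nat.zero_mod] at this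
    omega
  have hn : ∀ (T : Network k) (l : Fin k), ∀ z ∈ T.boundNames,
      z ∈ (Action.out Name.out (Name.id l)).names →
        ∃ x, Action.out Name.out (Name.id l) = .out x z ∧ x ≠ z := by
    intro T l z hz hz'
    simp only [Action.names, Finset.mem_insert, Finset.mem_singleton] at hz'
    rcases hz' with rfl | rfl
    · exact absurd hz out_notMem_boundNames
    · exact absurd hz (id_notMem_boundNames _)
  obtain ⟨C, m, hm, rfl, -⟩ := Computation.exists_of_reach hr
  obtain ⟨Q, hA⟩ := Proc.Can.exists_act (μ := .out Name.out (Name.id n)) hc (by simp [Action.bn])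
  obtain ⟨S₁, μ₁, R₁, hstep₁, hcomp₁, -, hμ₁⟩ :=
    (C.state m).exists_step_move hA (by simp [Action.bn]) (hn _ n)
  obtain rfl := hμ₁ (by simp)
  obtain ⟨C₁, hm₁, rfl, -, hl₁, -⟩ := C.exists_snoc hm hstep₁
  have hA' : Act ((C₁.state (m + 1)).comp (σ i)) (.out Name.out (Name.id (σ n : Fin k)))
      (Q.rename π) := by
    rw [hcomp₁, Function.update_of_ne (hσ i), hS.comp]
    simpa [Action.map, h.out, h.id] using hA.rename π.injective (by simp [Action.bn])
  obtain ⟨S₂, μ₂, R₂, hstep₂, -, -, hμ₂⟩ :=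
    (C₁.state (m + 1)).exists_step_move hA' (by simp [Action.bn]) (hn _ _)
  obtain rfl := hμ₂ (by simp)
  obtain ⟨C₂, hm₂, -, hlt₂, hl₂, -⟩ := C₁.exists_snoc hm₁ hstep₂
  obtain ⟨C', hext, n', -, hC'⟩ := hP C₂
  have hlen : ∀ a : ℕ, a < m + 2 → (a : ℕ∞) < C₂.length := fun a ha => by
    rw [hm₂]
    exact_mod_cast ha
  have h1 : C'.Contains (.out Name.out (Name.id n)) :=
    ⟨m, (hlen m (by omega)).trans_le hext.length_le, by
      rw [hext.label_eq m (hlen m (by omega)), (hlt₂ m (by omega)).1, hl₁]⟩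
  have h2 : C'.Contains (.out Name.out (Name.id (σ n : Fin k))) :=
    ⟨m + 1, (hlen (m + 1) (by omega)).trans_le hext.length_le, by
      rw [hext.label_eq _ (hlen (m + 1) (by omega)), hl₂]⟩
  -- The computation announces both `n` and `σ n`, and at least one of them differs from the elected
  -- leader.
  by_cases hnn : n = n'
  · exact hC' C' (.refl _) (σ n) (hnn ▸ hσ n) h2
  · exact hC' C' (.refl _) n hnn h1

theorem Balanced.exists_next_round (h : Rotation σ π p) (hP : P.IsElectoral)
    (hS : Balanced σ π S) (hr : Relation.ReflTransGen Next P S) :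
    ∃ S', Relation.TransGen Next S S' ∧ Balanced σ π S' := by
  have hq := hS.not_can_announce h hP hr
  obtain ⟨C, m, hm, rfl, hquiet⟩ := Computation.exists_of_reach hr
  obtain ⟨C', hext, n, hn, -⟩ := hP C
  obtain ⟨m', hm', hact⟩ := hn n
  -- The first `m` steps are quiet, so the promised announcement comes later; the extension
  -- therefore has a step out of the balanced state.
  have hle : m ≤ m' := by
    by_contra! hlt
    have := hext.act_eq m' (by rw [hm]; exact_mod_cast hlt)
    exact hquiet m' hlt n n (by rw [← this]; exact hact)
  have hstep := C'.step m (lt_of_le_of_lt (by exact_mod_cast hle) hm')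
  rw [hext.state_eq m hm.ge] at hstep
  exact hS.exists_round h hq hstep

/-- A balanced network has an infinite computation without announcements, if it is electoral. -/
theorem Balanced.not_isElectoral (h : Rotation σ π p) (hP : Balanced σ π P) :
    ¬ P.IsElectoral := by
  intro hE
  -- Balance holds only between rounds. For states inside a round, the invariant is that some
  -- balanced network can still be reached quietly.
  let G : Network k → Prop := fun S => Relation.ReflTransGen Next P S ∧
    ∃ S', Relation.ReflTransGen Next S S' ∧ Balanced σ π S'
  have hG : ∀ S : {S // G S}, ∃ T : {S // G S}, Next S.1 T.1 := by
    rintro ⟨S, hr, S', hSS', hS'⟩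
    obtain ⟨S'', hSS'', hS''⟩ : ∃ S'', Relation.TransGen Next S S'' ∧ Balanced σ π S'' := by
      obtain ⟨S'', h1, h2⟩ := hS'.exists_next_round h hE (hr.trans hSS')
      exact ⟨S'', Relation.TransGen.trans_right hSS' h1, h2⟩
    obtain ⟨T, h1, h2⟩ := Relation.TransGen.head'_iff.1 hSS''
    exact ⟨⟨T, hr.tail h1, S'', h2, hS''⟩, h1⟩
  choose next hnext using hG
  let state : ℕ → {S // G S} := fun m => next^[m] ⟨P, .refl, P, .refl, hP⟩
  have hstate : ∀ m, Next (state m).1 (state (m + 1)).1 := fun m => by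
    simp only [state, Function.iterate_succ_apply']
    exact hnext _
  choose act μ Q hstep hquiet using hstate
  -- Since its length is infinite, any extension of this computation contributes the same actions at
  -- every step.
  obtain ⟨C', hext, n, hn, -⟩ := hE ⟨⊤, fun m => (state m).1, μ, act, Q, rfl, fun m _ => hstep m⟩
  obtain ⟨m, -, hm⟩ := hn n
  have := hext.act_eq m (ENat.natCast_lt_top m)
  exact hquiet m n n (by rw [← hm]; exact (congrFun this n).symm)

end

/-! ### The action of the automorphism on all names -/

section

variable {P : Network k} (σ : P.hypergraph.Automorphism)

/-- Rotates the blocks of length `p` of the natural numbers. -/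
def rotateBlock (p m : ℕ) : ℕ := p * (m / p) + (m + 1) % p

theorem rotateBlock_iterate {p : ℕ} (hp : 0 < p) (m r : ℕ) :
    (rotateBlock p)^[r] m = p * (m / p) + (m + r) % p := by
  induction r with
  | zero => simp [Nat.div_add_mod]
  | succ r ih =>
    rw [Function.iterate_succ_apply', ih, rotateBlock, Nat.mul_add_div hp,
      Nat.div_eq_of_lt (Nat.mod_lt _ hp), add_zero, add_assoc, Nat.mul_add_mod, Nat.mod_add_mod,
      add_assoc]

/-- The permutation of the nodes. -/
def nodePerm : Equiv.Perm (Fin k) := σ.node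

/-- `σ` on the edges and on the names of the nodes, rotation of blocks of length `p` on the
channels from `ch N` on. -/
def nameMap (p N : ℕ) (x : Name) : Name :=
  if x ∈ P.edgeNames then P.onNames σ x else
    match x with
    | .out => .out
    | .id n => if h : n < k then .id (nodePerm σ ⟨n, h⟩ : Fin k) else .id n
    | .ch n => if n < N then .ch n else .ch (N + rotateBlock p (n - N))

variable {σ} {p N : ℕ}

theorem nameMap_of_mem {x : Name} (hx : x ∈ P.edgeNames) :
    nameMap σ p N x = P.onNames σ x := by
  unfold nameMap
  exact if_pos hx

theorem out_notMem_edgeNames : Name.out ∉ P.edgeNames := by simp [edgeNames]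

theorem nameMap_out : nameMap σ p N Name.out = Name.out := by
  rw [nameMap, if_neg out_notMem_edgeNames]

theorem nameMap_id (hσ : P.IsAutomorphism σ) (i : Fin k) :
    nameMap σ p N (Name.id i) = Name.id (nodePerm σ i : Fin k) := by
  by_cases h : Name.id i ∈ P.edgeNames
  · rw [nameMap_of_mem h, onNames, dif_pos h]
    exact hσ.edge_id i h
  · rw [nameMap, if_neg h]
    simp

theorem nameMap_ch (hN : ∀ n, ch n ∈ P.edgeNames → n < N) (m : ℕ) :
    nameMap σ p N (ch (N + m)) = ch (N + rotateBlock p m) := by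
  rw [nameMap, if_neg fun h => by have := hN _ h; omega]
  simp

theorem comp_nodePerm (hsym : P.SymmetricWrt σ) (i : Fin k) :
    P.comp (nodePerm σ i) = (P.comp i).rename (nameMap σ p N) := by
  refine (hsym.2 i).trans (Proc.rename_congr fun x hx => ?_)
  by_cases hx' : x ∈ P.edgeNames
  · rw [nameMap_of_mem hx']
  · obtain rfl : x = Name.out := by
      by_contra hne
      exact hx' (Finset.mem_erase.2 ⟨hne, Finset.mem_biUnion.2 ⟨i, Finset.mem_univ i, hx⟩⟩)
    rw [nameMap_out, onNames, dif_neg out_notMem_edgeNames]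

theorem comp_nodePerm_pow (hsym : P.SymmetricWrt σ) (r : ℕ) (i : Fin k) :
    P.comp ((nodePerm σ ^ r) i) = (P.comp i).rename (nameMap σ p N)^[r] := by
  induction r generalizing i with
  | zero => simp
  | succ r ih =>
    rw [pow_succ, Equiv.Perm.mul_apply, ih, comp_nodePerm hsym (p := p) (N := N),
      Proc.rename_rename, Function.iterate_succ]

/-- The hypothesis concerns nodes only. For edges the conclusion follows from symmetry: the `p`-th
iterate maps each component to itself, hence fixes its free names. -/
theorem nameMap_iterate_eq_self (hsym : P.SymmetricWrt σ) (hp : 0 < p)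
    (hN : ∀ n, ch n ∈ P.edgeNames → n < N) (hpow : nodePerm σ ^ p = 1) (x : Name) :
    (nameMap σ p N)^[p] x = x := by
  by_cases hx : x ∈ P.edgeNames
  · obtain ⟨-, hx⟩ := Finset.mem_erase.1 hx
    obtain ⟨i, -, hx⟩ := Finset.mem_biUnion.1 hx
    have := comp_nodePerm_pow (p := p) (N := N) hsym p i
    rw [hpow, Equiv.Perm.one_apply] at this
    exact (Proc.rename_eq_iff (g := _root_.id).1 (this.symm.trans (P.comp i).rename_id.symm)) x hx
  · cases x with
    | out => exact Function.iterate_fixed nameMap_out p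
    | id n =>
      by_cases hn : n < k
      · have : ∀ r (i : Fin k), (nameMap σ p N)^[r] (Name.id i) =
            Name.id ((nodePerm σ ^ r) i : Fin k) := by
          intro r
          induction r with
          | zero => simp
          | succ r ih =>
            intro i
            rw [Function.iterate_succ_apply, nameMap_id hsym.1, ih, pow_succ,
              Equiv.Perm.mul_apply]
        simpa [hpow] using this p ⟨n, hn⟩
      · refine Function.iterate_fixed ?_ p
        rw [nameMap, if_neg hx]
        simp [hn]
    | ch n =>
      by_cases hn : n < N
      · refine Function.iterate_fixed ?_ p
        rw [nameMap, if_neg hx]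
        simp [hn]
      · obtain ⟨m, rfl⟩ := Nat.exists_eq_add_of_le (not_lt.1 hn)
        have : Function.Semiconj (fun m => ch (N + m)) (rotateBlock p) (nameMap σ p N) :=
          fun m => (nameMap_ch hN m).symm
        have := (this.iterate_right p) m
        rw [← this, rotateBlock_iterate hp, Nat.add_mod_right, Nat.div_add_mod]

/-- `nameMap` as a permutation. -/
def namePerm (hsym : P.SymmetricWrt σ) (hp : 0 < p)
    (hN : ∀ n, ch n ∈ P.edgeNames → n < N) (hpow : nodePerm σ ^ p = 1) : Equiv.Perm Name where
  toFun := nameMap σ p N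
  invFun := (nameMap σ p N)^[p - 1]
  left_inv x := by
    rw [← Function.iterate_succ_apply (nameMap σ p N), Nat.succ_eq_add_one, Nat.sub_add_cancel hp,
      nameMap_iterate_eq_self hsym hp hN hpow]
  right_inv x := by
    rw [← Function.iterate_succ_apply' (nameMap σ p N), Nat.succ_eq_add_one, Nat.sub_add_cancel hp,
      nameMap_iterate_eq_self hsym hp hN hpow]

theorem namePerm_pow (hsym : P.SymmetricWrt σ) (hp : 0 < p)
    (hN : ∀ n, ch n ∈ P.edgeNames → n < N) (hpow : nodePerm σ ^ p = 1) (r : ℕ) (x : Name) :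
    (namePerm hsym hp hN hpow ^ r) x = (nameMap σ p N)^[r] x := by
  rw [← Equiv.Perm.iterate_eq_pow]
  rfl

theorem rotation_namePerm (hsym : P.SymmetricWrt σ) (hp : 2 ≤ p)
    (hN : ∀ n, ch n ∈ P.edgeNames → n < N) (hpow : nodePerm σ ^ p = 1)
    (hnode : ∀ (i : Fin k) (r s : ℕ), (nodePerm σ ^ r) i = (nodePerm σ ^ s) i ↔ r ≡ s [MOD p]) :
    Rotation (nodePerm σ) (namePerm hsym (by omega) hN hpow) p where
  two_le := hp
  pow_eq_one := Equiv.ext fun x => by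
    rw [namePerm_pow, nameMap_iterate_eq_self hsym (by omega) hN hpow, Equiv.Perm.one_apply]
  node := hnode
  out := nameMap_out (p := p) (N := N)
  id i := nameMap_id (p := p) (N := N) hsym.1 i
  fresh F := by
    have hpos : 0 < p := by omega
    obtain ⟨M, hM⟩ : ∃ M, ∀ n, ch n ∈ F → n < M := by
      obtain ⟨M, hM⟩ := (F.image fun | .ch n => n | _ => 0).exists_nat_subset_range
      exact ⟨M, fun n hn => Finset.mem_range.1 (hM (Finset.mem_image.2 ⟨_, hn, rfl⟩))⟩
    have key : ∀ r, (namePerm hsym hpos hN hpow ^ r) (ch (N + p * M)) =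
        ch (N + (p * M + r % p)) := fun r => by
      have : Function.Semiconj (fun m => ch (N + m)) (rotateBlock p) (nameMap σ p N) :=
        fun m => (nameMap_ch hN m).symm
      rw [namePerm_pow, ← (this.iterate_right r) (p * M), rotateBlock_iterate hpos,
        Nat.mul_div_cancel_left _ hpos, Nat.mul_add_mod]
    -- This is the start of a rotated block that lies entirely beyond the channels of `F`; its orbit
    -- is that block, which has `p` elements.
    refine ⟨N + p * M, fun r => ⟨_, key r, fun h => ?_⟩, fun r s h => ?_⟩
    · have h1 := hM _ h
      have h2 := Nat.le_mul_of_pos_left M hpos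
      omega
    · rw [key, key, ch.injEq] at h
      exact Nat.add_left_cancel (Nat.add_left_cancel h)

theorem balanced_namePerm (hP : P.Separate) (hsym : P.SymmetricWrt σ) (hp : 0 < p)
    (hN : ∀ n, ch n ∈ P.edgeNames → n < N) (hN' : ∀ n ∈ P.binders, n < N)
    (hpow : nodePerm σ ^ p = 1) :
    Balanced (nodePerm σ) (namePerm hsym hp hN hpow) P where
  comp := comp_nodePerm hsym
  bound z := by
    change nameMap σ p N z ∈ _ ↔ _
    by_cases hz : z ∈ P.edgeNames
    · rw [nameMap_of_mem hz, onNames, dif_pos hz]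
      exact (hsym.1.bound_iff ⟨z, hz⟩).symm
    · cases z with
      | out => rw [nameMap_out]
      | id n =>
        rw [nameMap, if_neg hz]
        refine iff_of_false ?_ (id_notMem_boundNames n)
        split_ifs <;> exact id_notMem_boundNames _
      | ch n =>
        by_cases hn : n < N
        · rw [nameMap, if_neg hz]
          simp [hn]
        · obtain ⟨m, rfl⟩ := Nat.exists_eq_add_of_le (not_lt.1 hn)
          rw [nameMap_ch hN]
          have : ∀ a, ch (N + a) ∉ P.boundNames := by
            rintro a ⟨b, hb, e⟩
            have := hN' b hb
            simp only [ch.injEq] at e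
            omega
          exact iff_of_false (this _) (this _)
  separate := hP

/-! ### Orbit sizes and minimal periods. -/

theorem pow_apply_eq_iff_modEq (τ : Equiv.Perm (Fin k)) (i : Fin k) (r s : ℕ) :
    (τ ^ r) i = (τ ^ s) i ↔ r ≡ s [MOD Function.minimalPeriod τ i] := by
  wlog hrs : r ≤ s generalizing r s
  · rw [eq_comm, this s r (by omega), Nat.ModEq.comm]
  obtain ⟨d, rfl⟩ := Nat.exists_eq_add_of_le hrs
  rw [pow_add, Equiv.Perm.mul_apply, (τ ^ r).injective.eq_iff, Nat.modEq_iff_dvd' hrs,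
    Nat.add_sub_cancel_left, ← Function.isPeriodicPt_iff_minimalPeriod_dvd,
    Function.IsPeriodicPt, Function.IsFixedPt, Equiv.Perm.iterate_eq_pow, eq_comm]

theorem minimalPeriod_pos (τ : Equiv.Perm (Fin k)) (i : Fin k) :
    0 < Function.minimalPeriod τ i :=
  Function.minimalPeriod_pos_of_mem_periodicPts (τ.injective.mem_periodicPts i)

theorem ncard_orbit (i : Fin k) :
    (σ.orbit i).ncard = Function.minimalPeriod (nodePerm σ) i := by
  have : @Eq (Set (Fin k)) (σ.orbit i) (((Finset.range (Function.minimalPeriod (nodePerm σ) i)).image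
      fun r => (nodePerm σ ^ r) i : Finset (Fin k)) : Set (Fin k)) := by
    ext m
    simp only [Finset.coe_image, Finset.coe_range]
    constructor
    · rintro ⟨r, rfl⟩
      exact ⟨r % _, Nat.mod_lt _ (minimalPeriod_pos _ i),
        (pow_apply_eq_iff_modEq (nodePerm σ) i _ _).2 (Nat.mod_modEq _ _)⟩
    · rintro ⟨r, -, h⟩
      exact ⟨r, h⟩
  change Set.ncard (α := Fin k) (σ.orbit i) = _
  rw [this, Set.ncard_coe_finset]
  rw [Finset.card_image_of_injOn, Finset.card_range]
  intro r hr s hs h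
  simp only [Finset.coe_range, Set.mem_Iio] at hr hs
  exact ((pow_apply_eq_iff_modEq _ i r s).1 h).eq_of_lt_of_lt hr hs

/-- If the nodes are fixed, each component equals its own renaming, so all its free names are fixed.
As every edge is free in some component, the edges are fixed too. -/
theorem nodePerm_ne_one (hsym : P.SymmetricWrt σ)
    (hne : σ ≠ Hypergraph.Automorphism.id P.hypergraph) : nodePerm σ ≠ 1 := by
  intro h
  refine hne ?_
  have hedge : σ.edge = Equiv.refl _ := Equiv.ext fun ⟨x, hx⟩ => Subtype.ext ?_
  · obtain ⟨node, edge, hσ⟩ := σ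
    obtain rfl : node = Equiv.refl _ := h
    obtain rfl : edge = Equiv.refl _ := hedge
    rfl
  · obtain ⟨-, hx'⟩ := Finset.mem_erase.1 hx
    obtain ⟨i, -, hx'⟩ := Finset.mem_biUnion.1 hx'
    have h1 := hsym.2 i
    rw [show σ.node i = i from Equiv.congr_fun h i] at h1
    have := (Proc.rename_eq_iff (g := _root_.id).1 (h1.symm.trans (P.comp i).rename_id.symm)) x hx'
    rwa [onNames, dif_pos hx] at this

end

end Network

end PiCalc

/-! ### Assembly of the main theorem. -/

theorem mainTheorem2 (k : ℕ) (P : PiCalc.Network k) (hP : P.Separate)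
    (σ : P.hypergraph.Automorphism) (hσ : σ.WellBalanced)
    (hne : σ ≠ PiCalc.Hypergraph.Automorphism.id P.hypergraph)
    (hsym : P.SymmetricWrt σ) :
    ¬ P.IsElectoral := by
  have h1 := PiCalc.Network.nodePerm_ne_one hsym hne
  obtain ⟨i, hi⟩ : ∃ i, PiCalc.Network.nodePerm σ i ≠ i := by
    by_contra! h
    exact h1 (Equiv.ext h)
  have hmod : ∀ (j : Fin k) (r s : ℕ), (PiCalc.Network.nodePerm σ ^ r) j =
      (PiCalc.Network.nodePerm σ ^ s) j ↔
        r ≡ s [MOD Function.minimalPeriod (PiCalc.Network.nodePerm σ) i] := by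
    intro j r s
    -- Well-balancedness is used here: the period found at the moved node `i` serves for every node
    -- `j`.
    rw [PiCalc.Network.pow_apply_eq_iff_modEq, ← PiCalc.Network.ncard_orbit,
      ← PiCalc.Network.ncard_orbit, hσ j i]
  have hpos := PiCalc.Network.minimalPeriod_pos (PiCalc.Network.nodePerm σ) i
  generalize Function.minimalPeriod (PiCalc.Network.nodePerm σ) i = p at hmod hpos
  have hp : 2 ≤ p := by
    by_contra! hlt
    obtain rfl : p = 1 := by omega
    exact hi (by simpa using (hmod i 1 0).2 (Nat.modEq_one))
  have hpow : PiCalc.Network.nodePerm σ ^ p = 1 :=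
    Equiv.ext fun j => by simpa using (hmod j p 0).2 (by simp [Nat.ModEq])
  -- Beyond `N` no channel is free in a component or globally bound, so the rotated blocks interfere
  -- with neither.
  obtain ⟨N, hN⟩ : ∃ N, ∀ n, PiCalc.Name.ch n ∈ P.support → n < N := by
    obtain ⟨N, hN⟩ := (P.support.image fun | .ch n => n | _ => 0).exists_nat_subset_range
    exact ⟨N, fun n hn => Finset.mem_range.1 (hN (Finset.mem_image.2 ⟨_, hn, rfl⟩))⟩
  have hN1 : ∀ n, PiCalc.Name.ch n ∈ P.edgeNames → n < N := fun n hn =>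
    hN n (Finset.mem_union_left _ (Finset.mem_of_mem_erase hn))
  have hN2 : ∀ n ∈ P.binders, n < N := fun n hn =>
    hN n (PiCalc.Network.mem_support_of_bound ⟨n, hn, rfl⟩)
  exact (PiCalc.Network.balanced_namePerm hP hsym hpos hN1 hN2 hpow).not_isElectoral
    (PiCalc.Network.rotation_namePerm hsym hp hN1 hpow hmod)
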